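/- Let $\mathbb F$ be a field of characteristic not $2$; gradings are by $\mathbb Z_2=\mathbb Z/2$. **The algebra.** Let $\mathcal A=\mathcal A_0\oplus\mathcal A_1$ be a polarized $\mathbb Z_2$-graded associative $\mathbb F$-algebra: it carries a nondegenerate bilinear form with $\langle\mathcal A_0,\mathcal A_1\rangle=0$, $\langle u,v\rangle=(-1)^{i_1i_2}\langle v,u\rangle$ for $u\in\mathcal A_{i_1},v\in\mathcal A_{i_2}$, and $\langle uv,w\rangle=\langle u,vw\rangle$, and $\mathcal A=\mathcal A^+\oplus\mathcal A^-$ with $\mathbb Z_2$-graded subalgebras $\mathcal A^\pm$ that are isotropic, $\langle\mathcal A^\pm,\mathcal A^\pm\rangle=0$. Put $\mathcal A^{(0)}=\{u\in\mathcal A^+: \mathcal A^-u\subset\mathcal A^-\}$ and $\mathcal A^{(m+1)}=\{u\in\mathcal A^+:\mathcal A^-u\subset\mathcal A^{(m)}+\mathcal A^-\}$ for $m\ge 0$, and assume that $\mathcal A$ is semi-finitely-filtered: $\mathcal A^+=\bigcup_m\mathcal A^{(m)}$ and $\dim\mathcal A^{(m)}<\infty$ for all $m$. **Bases.** For $i\in\mathbb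 Z_2$ let $\{\varsigma_{i,j}: j\in J_i\}$ be a basis of $\mathcal A^+_i=\mathcal A^+\cap\mathcal A_i$ such that, for every $m$, those $\varsigma_{i,j}$ which lie in $\mathcal A^{(m)}$ form a basis of $\mathcal A^{(m)}\cap\mathcal A_i$, and let $\varsigma_{i,-j}\in\mathcal A^-\cap\mathcal A_i$ ($j\in J_i$) be a dual family: $\langle\varsigma_{i_1,-j_1},\varsigma_{i_2,j_2}\rangle=\delta_{i_1,i_2}\delta_{j_1,j_2}$. An element $u\in\mathcal A$ is identified with its formal expansion $\sum_{i,j}\langle u,\varsigma_{i,j}\rangle\varsigma_{i,-j}+\sum_{i,j}\langle\varsigma_{i,-j},u\rangle\varsigma_{i,j}$, whose first sum may be infinite. **Polynomials.** Fix a positive integer $\iota$, and let $I_i$ consist of all $-j$ with $j\in J_i$ and of those $j\in J_i$ with $\varsigma_{i,j}\in\mathcal A^{(\iota)}$. Let $\mathcal P=\mathcal P_0\oplus\mathcal P_1$ be the algebra of supersymmetric polynomials over $\mathbb F$ in variables $x_{i,j}$ ($i\in\mathbb Z_2$, $j\in I_i$), $x_{i,j}$ of parity $i$: polynomials in the $x_{0,j}$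 tensored with the exterior algebra on the $x_{1,j}$. Let $\partial_{i,j}$ be the superderivation of $\mathcal P$ of parity $i$ (that is, $\partial_{i,j}(fg)=\partial_{i,j}(f)g+(-1)^{ip}f\partial_{i,j}(g)$ for $f\in\mathcal P_p$) that maps $x_{i,j}$ to $1$ and all other variables to $0$. **Extension of scalars.** Let $\bar{\mathcal G}$ be the space of formal sums $\varsigma_\xi=\sum\xi_{i,j}\varsigma_{i,j}+\sum\xi_{i,-j}\varsigma_{i,-j}$ over $i\in\mathbb Z_2$, $j\in J_i$, with coefficients in $\mathcal P$, the first sum being finite and the second possibly infinite; a term $\xi\varsigma_{i,\pm j}$ with $\xi\in\mathcal P_q$ has parity $q+i$. The product and the $\mathcal P$-valued bilinear form of $\bar{\mathcal G}$ are given, for $\varsigma_\eta$ of parity $p$, by $$\varsigma_\xi\varsigma_\eta=\sum(-1)^{i_1(i_2+p)}\xi_{i_1,j_1}\eta_{i_2,j_2}\,\varsigma_{i_1,j_1}\varsigma_{i_2,j_2},\qquad \langle\varsigma_\xi,\varsigma_\eta\rangle=\sum_{i\in\mathbb Z_2,\,j\in J_i}(-1)^{i(i+p)}\bigl(\xi_{i,-j}\eta_{i,j}+(-1)^i\xi_{i,j}\eta_{i,-j}\bigr),$$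 the first sum being over all indices, positive and negative (each coefficient of the product is a finite sum). Let $[u,v]=uv-(-1)^{pq}vu$ for $u,v$ of parities $p,q$, extended bilinearly, and let $u_+$, $u_-$ be the parts of $u\in\bar{\mathcal G}$ in the $\varsigma_{i,j}$ and in the $\varsigma_{i,-j}$, $j\in J_i$. For $f=f_0+f_1\in\mathcal P$, $f_p\in\mathcal P_p$, put $$\varsigma_{(f)}=\sum_{i,\;j\in J_i}\bigl((-1)^i\partial_{i,-j}f_0+\partial_{i,-j}f_1\bigr)\varsigma_{i,j}+\sum_{i,\;j\in J_i\cap I_i}\bigl(\partial_{i,j}f_0+(-1)^i\partial_{i,j}f_1\bigr)\varsigma_{i,-j}.$$ **The brackets.** Let $L_0\in\mathcal A^-_0+\mathcal A^{(\iota+1)}_0$, where $\mathcal A^-_0=\mathcal A^-\cap\mathcal A_0$ and $\mathcal A^{(\iota+1)}_0=\mathcal A^{(\iota+1)}\cap\mathcal A_0$; let $L=L_0+\sum_{i\in\mathbb Z_2,\,j\in I_i}x_{i,j}\varsigma_{i,j}$, and let $\kappa\in\mathcal A^-_0+\mathcal A^{(\iota+1)}_0$ be a central element of $\mathcal A$.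 For $f,g\in\mathcal P$ put $$\{f,g\}_1=\bigl\langle L,\,[\varsigma_{(f)},(\kappa\varsigma_{(g)})_+]-[(\kappa\varsigma_{(f)})_-,\varsigma_{(g)}]\bigr\rangle,\qquad \{f,g\}_2=\bigl\langle (L\varsigma_{(f)})_-L-L(\varsigma_{(f)}L)_-,\,\varsigma_{(g)}\bigr\rangle .$$ **Theorem.** The brackets $\{\cdot,\cdot\}_1$ and $\{\cdot,\cdot\}_2$ form a Poisson superpair on $\mathcal P$: for all $c_1,c_2\in\mathbb F$, the bracket $\{\cdot,\cdot\}=c_1\{\cdot,\cdot\}_1+c_2\{\cdot,\cdot\}_2$ is a Poisson superbracket on the super commutative algebra $\mathcal P$. That is, it is bilinear, $\{\mathcal P_i,\mathcal P_j\}\subset\mathcal P_{i+j}$, and for $f\in\mathcal P_i$, $g\in\mathcal P_j$, $h\in\mathcal P$, $$\{f,g\}=-(-1)^{ij}\{g,f\},\quad \{f,\{g,h\}\}=\{\{f,g\},h\}+(-1)^{ij}\{g,\{f,h\}\},\quad \{f,gh\}=\{f,g\}h+(-1)^{ij}g\{f,h\}.$$ -/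

import Mathlib

open scoped TensorProduct

noncomputable section

namespace PoissonSuper

/-! ### Signs, and Poisson superbrackets on super commutative algebras -/

/-- The sign `(-1)^i` of a parity `i`, as an element of the ground field. -/
def sgn (F : Type*) [Field F] (i : ZMod 2) : F := if i = 0 then 1 else -1

/-- `B = B_0 ⊕ B_1` is a `ℤ/2`-graded associative algebra with `f g = (-1)^{ij} g f` for
`f ∈ B_i`, `g ∈ B_j`. -/
structure IsSuperCommutative {F B : Type*} [Field F] [Ring B] [Algebra F B]
    (gr : ZMod 2 → Submodule F B) : Prop where
  isCompl : IsCompl (gr 0) (gr 1)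
  one_mem : (1 : B) ∈ gr 0
  mul_mem : ∀ {i j : ZMod 2} {f g : B}, f ∈ gr i → g ∈ gr j → f * g ∈ gr (i + j)
  comm : ∀ {i j : ZMod 2} {f g : B}, f ∈ gr i → g ∈ gr j → f * g = sgn F (i * j) • (g * f)

/-- `br` is a Poisson superbracket on the super commutative algebra `B = B_0 ⊕ B_1`: it is
bilinear, it makes `B` a Lie superalgebra, and it is a superderivation in its second argument. -/
structure IsPoissonSuperbracket {F B : Type*} [Field F] [Ring B] [Algebra F B]
    (gr : ZMod 2 → Submodule F B) (br : B → B → B) : Prop where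
  superCommutative : IsSuperCommutative gr
  add_left : ∀ f g h : B, br (f + g) h = br f h + br g h
  add_right : ∀ f g h : B, br f (g + h) = br f g + br f h
  smul_left : ∀ (c : F) (f g : B), br (c • f) g = c • br f g
  smul_right : ∀ (c : F) (f g : B), br f (c • g) = c • br f g
  even : ∀ {i j : ZMod 2} {f g : B}, f ∈ gr i → g ∈ gr j → br f g ∈ gr (i + j)
  skew : ∀ {i j : ZMod 2} {f g : B}, f ∈ gr i → g ∈ gr j → br f g = -(sgn F (i * j) • br g f)
  jacobi : ∀ {i j : ZMod 2} {f g : B}, f ∈ gr i → g ∈ gr j → ∀ h : B,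
    br f (br g h) = br (br f g) h + sgn F (i * j) • br g (br f h)
  leibniz : ∀ {i j : ZMod 2} {f g : B}, f ∈ gr i → g ∈ gr j → ∀ h : B,
    br f (g * h) = br f g * h + sgn F (i * j) • (g * br f h)

/-- Two brackets form a Poisson superpair if all their linear combinations are Poisson
superbrackets. -/
def IsPoissonSuperpair {F B : Type*} [Field F] [Ring B] [Algebra F B]
    (gr : ZMod 2 → Submodule F B) (br₁ br₂ : B → B → B) : Prop :=
  ∀ c₁ c₂ : F, IsPoissonSuperbracket gr (fun f g => c₁ • br₁ f g + c₂ • br₂ f g)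

/-! ### Supersymmetric polynomials -/

/-- The algebra of supersymmetric polynomials over `F` in the variables `v : V`, where `v` has
parity `par v`: ordinary polynomials in the even variables, tensor the exterior algebra on the
odd ones. -/
abbrev SuperPoly (F : Type*) [Field F] {V : Type*} (par : V → ZMod 2) : Type _ :=
  MvPolynomial {v : V // par v = 0} F ⊗[F] ExteriorAlgebra F ({v : V // par v ≠ 0} →₀ F)

namespace SuperPoly

variable {F : Type*} [Field F] {V : Type*} (par : V → ZMod 2)

/-- The variable `x_v`. -/
def X (v : V) : SuperPoly F par :=
  if h : par v = 0 then MvPolynomial.X ⟨v, h⟩ ⊗ₜ[F] 1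
  else 1 ⊗ₜ[F] ExteriorAlgebra.ι F (Finsupp.single ⟨v, h⟩ (1 : F))

/-- The homogeneous part of parity `i`. -/
def part (i : ZMod 2) : Submodule F (SuperPoly F par) :=
  LinearMap.range (LinearMap.lTensor (MvPolynomial {v : V // par v = 0} F)
    (CliffordAlgebra.evenOdd (0 : QuadraticForm F ({v : V // par v ≠ 0} →₀ F)) i).subtype)

/-- The projection `f ↦ f_i` onto the homogeneous part of parity `i`. -/
def comp (i : ZMod 2) : SuperPoly F par →ₗ[F] SuperPoly F par :=
  LinearMap.lTensor (MvPolynomial {v : V // par v = 0} F)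
    (GradedAlgebra.proj
      (CliffordAlgebra.evenOdd (0 : QuadraticForm F ({v : V // par v ≠ 0} →₀ F))) i)

/-- `f ↦ f_0 + (-1)^i f_1`, the sign change of `f` when it is moved past a symbol of parity `i`. -/
def twist (i : ZMod 2) : SuperPoly F par →ₗ[F] SuperPoly F par :=
  comp par 0 + sgn F i • comp par 1

/-- The left partial derivative `∂_v`: the superderivation of parity `par v` which maps `x_v` to
`1` and all the other variables to `0`. -/
def pd (v : V) : SuperPoly F par →ₗ[F] SuperPoly F par :=
  if h : par v = 0 then
    LinearMap.rTensor (ExteriorAlgebra F ({v : V // par v ≠ 0} →₀ F))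
      (MvPolynomial.pderiv (R := F) (⟨v, h⟩ : {v : V // par v = 0})).toLinearMap
  else
    LinearMap.lTensor (MvPolynomial {v : V // par v = 0} F)
      (CliffordAlgebra.contractLeft (Q := (0 : QuadraticForm F ({v : V // par v ≠ 0} →₀ F)))
        (Finsupp.lapply (⟨v, h⟩ : {v : V // par v ≠ 0})))

theorem pd_X_self (v : V) : pd par v (X par v) = (1 : SuperPoly F par) := by
  by_cases h : par v = 0
  · simp [pd, X, h, Algebra.TensorProduct.one_def]
  · simp [pd, X, h, Algebra.TensorProduct.one_def, CliffordAlgebra.contractLeft_ι, ExteriorAlgebra.ι]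

theorem pd_X_of_ne {v w : V} (hvw : v ≠ w) : pd par v (X par w) = (0 : SuperPoly F par) := by
  by_cases h : par v = 0 <;> by_cases h' : par w = 0
  · simp [pd, X, h, h', MvPolynomial.pderiv_X_of_ne, Ne.symm hvw]
  · simp [pd, X, h, h']
  · simp [pd, X, h, h']
  · simp [pd, X, h, h', CliffordAlgebra.contractLeft_ι, ExteriorAlgebra.ι, hvw.symm]

theorem contractLeft_mul {M : Type*} [AddCommGroup M] [Module F M] (d : Module.Dual F M)
    (a b : ExteriorAlgebra F M) :
    CliffordAlgebra.contractLeft d (a * b) =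
      CliffordAlgebra.contractLeft d a * b +
        CliffordAlgebra.involute a * CliffordAlgebra.contractLeft d b := by
  induction a using CliffordAlgebra.left_induction with
  | algebraMap r =>
    simp [CliffordAlgebra.contractLeft_algebraMap_mul, CliffordAlgebra.contractLeft_algebraMap]
  | add x y hx hy => simp only [add_mul, map_add, hx, hy]; abel
  | ι_mul x m hx =>
    simp only [mul_assoc, CliffordAlgebra.contractLeft_ι_mul, hx, map_mul, CliffordAlgebra.involute_ι, sub_mul, smul_mul_assoc, neg_mul, mul_add]
    abel

theorem comp_eq (i : ZMod 2) (f : MvPolynomial {v : V // par v = 0} F)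
   (w) (hw : w ∈ CliffordAlgebra.evenOdd (0 : QuadraticForm F ({v : V // par v ≠ 0} →₀ F)) i) (j) :
   comp par j (f ⊗ₜ[F] w) = if i = j then f ⊗ₜ[F] w else 0 := by
  simp [comp, DirectSum.decompose_of_mem _ hw, DirectSum.of_apply]
  by_cases h : i = j
  · subst h; simp
  · simp [h]

theorem twist_tmul (i : ZMod 2) (f : MvPolynomial {v : V // par v = 0} F)
    (w : ExteriorAlgebra F ({v : V // par v ≠ 0} →₀ F)) :
    twist par i (f ⊗ₜ[F] w) = f ⊗ₜ[F] (if i = 0 then w else CliffordAlgebra.involute w) := by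
  have : w ∈ CliffordAlgebra.evenOdd (0 : QuadraticForm F ({v : V // par v ≠ 0} →₀ F)) 0 ⊔ CliffordAlgebra.evenOdd (0 : QuadraticForm F ({v : V // par v ≠ 0} →₀ F)) 1 := by
    rw [(CliffordAlgebra.evenOdd_isCompl _).sup_eq_top]; trivial
  obtain ⟨a, ha, b, hb, rfl⟩ := Submodule.mem_sup.1 this
  simp only [twist, TensorProduct.tmul_add, LinearMap.add_apply, LinearMap.smul_apply, map_add, comp_eq par 0 f a ha, comp_eq par 1 f b hb, CliffordAlgebra.involute_eq_of_mem_even ha, CliffordAlgebra.involute_eq_of_mem_odd hb]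
  by_cases h : i = 0 <;> simp [h, sgn, TensorProduct.tmul_add, TensorProduct.tmul_neg]

/-- pd is a left superderivation of parity par v -/
theorem pd_mul (v : V) (f g : SuperPoly F par) :
    pd par v (f * g) = pd par v f * g + twist par (par v) f * pd par v g := by
  induction f using TensorProduct.induction_on with
  | zero => simp
  | add x y hx hy => simp only [add_mul, map_add, hx, hy]; abel
  | tmul p a =>
  induction g using TensorProduct.induction_on with
  | zero => simp
  | add x y hx hy => simp only [mul_add, map_add, hx, hy]; abel
  | tmul q b =>
  rw [twist_tmul]
  by_cases h : par v = 0
  · have e : MvPolynomial.pderiv (⟨v, h⟩ : {v : V // par v = 0}) (p * q) =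
        MvPolynomial.pderiv ⟨v, h⟩ p * q + p * MvPolynomial.pderiv ⟨v, h⟩ q := by
      rw [Derivation.leibniz, smul_eq_mul, smul_eq_mul]; ring
    simp only [pd, h, dite_true, if_true, Algebra.TensorProduct.tmul_mul_tmul,
      LinearMap.rTensor_tmul, Derivation.coeFn_coe, e, TensorProduct.add_tmul]
  · simp [pd, h, contractLeft_mul, TensorProduct.tmul_add]

end SuperPoly

/-! ### Polarized `ℤ/2`-graded associative algebras -/

/-- A polarized `ℤ/2`-graded associative algebra structure on an associative algebra `A`
(which need not have a unit): a grading `A = A_0 ⊕ A_1`, a nondegenerate even supersymmetric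
associative bilinear form, and graded isotropic subalgebras `A^+`, `A^-` with
`A = A^+ ⊕ A^-`. -/
structure PolarizedAlgebra (F A : Type*) [Field F] [NonUnitalRing A] [Module F A]
    [IsScalarTower F A A] [SMulCommClass F A A] where
  gr : ZMod 2 → Submodule F A
  gr_isCompl : IsCompl (gr 0) (gr 1)
  gr_mul : ∀ {i j : ZMod 2} {a b : A}, a ∈ gr i → b ∈ gr j → a * b ∈ gr (i + j)
  form : A →ₗ[F] A →ₗ[F] F
  form_nondegenerate : form.Nondegenerate
  form_even : ∀ {a b : A}, a ∈ gr 0 → b ∈ gr 1 → form a b = 0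
  form_symm : ∀ {i j : ZMod 2} {a b : A}, a ∈ gr i → b ∈ gr j →
    form a b = sgn F (i * j) * form b a
  form_assoc : ∀ a b c : A, form (a * b) c = form a (b * c)
  pos : NonUnitalSubalgebra F A
  neg : NonUnitalSubalgebra F A
  pos_graded : pos.toSubmodule = (pos.toSubmodule ⊓ gr 0) ⊔ (pos.toSubmodule ⊓ gr 1)
  neg_graded : neg.toSubmodule = (neg.toSubmodule ⊓ gr 0) ⊔ (neg.toSubmodule ⊓ gr 1)
  pos_isotropic : ∀ {a b : A}, a ∈ pos → b ∈ pos → form a b = 0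
  neg_isotropic : ∀ {a b : A}, a ∈ neg → b ∈ neg → form a b = 0
  polarization : IsCompl pos.toSubmodule neg.toSubmodule

namespace PolarizedAlgebra

variable {F A : Type*} [Field F] [NonUnitalRing A] [Module F A]
  [IsScalarTower F A A] [SMulCommClass F A A]

/-- `{u ∈ A^+ | A^- u ⊆ W + A^-}` -/
def filtStep (S : PolarizedAlgebra F A) (W : Submodule F A) : Submodule F A where
  carrier := {u | u ∈ S.pos ∧ ∀ a ∈ S.neg, a * u ∈ W ⊔ S.neg.toSubmodule}
  zero_mem' := ⟨zero_mem _, fun a _ => by rw [mul_zero]; exact zero_mem _⟩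
  add_mem' := fun hu hv =>
    ⟨add_mem hu.1 hv.1, fun a ha => by rw [mul_add]; exact add_mem (hu.2 a ha) (hv.2 a ha)⟩
  smul_mem' := fun c _ hu =>
    ⟨SMulMemClass.smul_mem c hu.1, fun a ha => by
      rw [mul_smul_comm]; exact Submodule.smul_mem _ c (hu.2 a ha)⟩

/-- The subspaces `A^(m)`, `m ∈ ℕ`: `A^(0) = {u ∈ A^+ | A^- u ⊆ A^-}` and
`A^(m+1) = {u ∈ A^+ | A^- u ⊆ A^(m) + A^-}`. -/
def filt (S : PolarizedAlgebra F A) : ℕ → Submodule F A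
  | 0 => S.filtStep ⊥
  | m + 1 => S.filtStep (S.filt m)

/-- `A` is semi-finitely-filtered: `A^+ = ⋃ A^(m)`, and all `A^(m)` are finite-dimensional. -/
structure IsSemiFinitelyFiltered (S : PolarizedAlgebra F A) : Prop where
  exhaustive : ∀ u ∈ S.pos, ∃ m, u ∈ S.filt m
  finiteDimensional : ∀ m, FiniteDimensional F (S.filt m)

/-- A homogeneous basis `ς_j` (`j : J`, of parity `par j`) of `A^+` which is adapted to the
subspaces `A^(m)`, together with a dual family `ς_{-j}` in `A^-`. -/
structure DualBases (S : PolarizedAlgebra F A) (J : Type*) where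
  par : J → ZMod 2
  /-- `ς_j` -/
  pos : J → A
  /-- `ς_{-j}` -/
  neg : J → A
  pos_mem : ∀ j, pos j ∈ S.pos.toSubmodule ⊓ S.gr (par j)
  neg_mem : ∀ j, neg j ∈ S.neg.toSubmodule ⊓ S.gr (par j)
  linearIndependent : LinearIndependent F pos
  span_eq : Submodule.span F (Set.range pos) = S.pos.toSubmodule
  /-- the basis elements that lie in `A^(m)` form a basis of `A^(m)` -/
  adapted : ∀ m, Submodule.span F {u | u ∈ S.filt m ∧ u ∈ Set.range pos} = S.filt m
  dual_self : ∀ j, S.form (neg j) (pos j) = 1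
  dual_ne : ∀ j k, j ≠ k → S.form (neg j) (pos k) = 0

/-- The subspace `A^-_0 + A^(m)_0`. -/
def evenBounded (S : PolarizedAlgebra F A) (m : ℕ) : Submodule F A :=
  (S.neg.toSubmodule ⊓ S.gr 0) ⊔ (S.filt m ⊓ S.gr 0)

namespace DualBases

variable {S : PolarizedAlgebra F A} {J : Type*} (D : S.DualBases J) (r : ℕ)

/-- The indices of the family `ς`: `Sum.inl j` stands for `-j`, and `Sum.inr j` for `j`. -/
abbrev Idx (_ : S.DualBases J) : Type _ := J ⊕ J

/-- The parity of an index. -/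
def ipar : D.Idx → ZMod 2 := Sum.elim D.par D.par

/-- The family `ς_{-j}`, `ς_j`. -/
def elt : D.Idx → A := Sum.elim D.neg D.pos

/-- The coefficients of `a ∈ A` in its (possibly infinite) expansion in the `ς_{-j}` and `ς_j`;
by duality, they are `⟨a, ς_j⟩` at `ς_{-j}` and `⟨ς_{-j}, a⟩` at `ς_j`. -/
def coeff (a : A) : D.Idx → F :=
  Sum.elim (fun j => S.form a (D.pos j)) (fun j => S.form (D.neg j) a)

/-- The index set of the variables `x_c`: all negative indices, and those positive indices `j` for
which `ς_j ∈ A^(r)`. -/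
abbrev Var : Type _ := J ⊕ {j : J // D.pos j ∈ S.filt r}

/-- The parity of a variable. -/
def vpar : D.Var r → ZMod 2 := Sum.elim D.par (fun j => D.par j.1)

/-- The algebra `𝒫` of supersymmetric polynomials in the variables `x_c`. -/
abbrev Poly : Type _ := SuperPoly F (D.vpar r)

/-- Formal sums `ς_ξ = ∑_c ξ_c ς_c` with coefficients in `𝒫`, given by their coefficients. -/
abbrev Formal : Type _ := D.Idx → D.Poly r

/-- The space `𝒢̄` of those formal sums which involve only finitely many of the `ς_j` (and
arbitrarily many of the `ς_{-j}`). All the formal sums below that enter the brackets lie in it. -/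
def Gbar : Submodule F (D.Formal r) where
  carrier := {u | {j : J | u (Sum.inr j) ≠ 0}.Finite}
  zero_mem' := by simp
  add_mem' := fun {u v} hu hv => by
    refine (Set.Finite.union hu hv).subset fun j hj => ?_
    by_contra h
    simp only [Set.mem_union, Set.mem_ofPred_eq, not_or, not_not] at h
    exact hj (by simp [h.1, h.2])
  smul_mem' := fun c u hu => by
    refine Set.Finite.subset hu fun j hj h => hj ?_
    simp [h]

/-- An element of `A` as a formal sum. -/
def emb (a : A) : D.Formal r := fun c => algebraMap F (D.Poly r) (D.coeff a c)

/-- The coefficient at `ς_c` of the product `ς_ξ ς_η`, in which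
`(ξ_a ς_a) (η_b ς_b) = ± ξ_a η_b (ς_a ς_b)`, the sign arising from moving `ς_a` past `η_b`. -/
def mul (u v : D.Formal r) : D.Formal r := fun c =>
  ∑ᶠ p : D.Idx × D.Idx, D.coeff (D.elt p.1 * D.elt p.2) c •
    (u p.1 * SuperPoly.twist (D.vpar r) (D.ipar p.1) (v p.2))

/-- The `𝒫`-valued bilinear form `⟨ς_ξ, ς_η⟩`, in which
`⟨ξ_a ς_a, η_b ς_b⟩ = ± ξ_a η_b ⟨ς_a, ς_b⟩`, with the same sign as in the product. -/
def pairing (u v : D.Formal r) : D.Poly r :=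
  ∑ᶠ j : J,
    (u (Sum.inl j) * SuperPoly.twist (D.vpar r) (D.par j) (v (Sum.inr j)) +
      sgn F (D.par j) •
        (u (Sum.inr j) * SuperPoly.twist (D.vpar r) (D.par j) (v (Sum.inl j))))

/-- `u ↦ u_+` -/
def plus (u : D.Formal r) : D.Formal r := Sum.elim 0 (fun j => u (Sum.inr j))

/-- `u ↦ u_-` -/
def minus (u : D.Formal r) : D.Formal r := Sum.elim (fun j => u (Sum.inl j)) 0

/-- The component of parity `p` of a formal sum: the term `ξ_c ς_c` has parity `p` if `ξ_c` has
parity `p` plus that of `ς_c`. -/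
def comp (p : ZMod 2) (u : D.Formal r) : D.Formal r :=
  fun c => SuperPoly.comp (D.vpar r) (D.ipar c + p) (u c)

/-- The supercommutator: the bilinear operation with `[u, v] = u v - (-1)^{pq} v u` for `u` of
parity `p` and `v` of parity `q`. -/
def commutator (u v : D.Formal r) : D.Formal r :=
  ∑ p : ZMod 2, ∑ q : ZMod 2,
    (D.mul r (D.comp r p u) (D.comp r q v) -
      sgn F (p * q) • D.mul r (D.comp r q v) (D.comp r p u))

open Classical in
/-- `∑_c x_c ς_c`, the sum over all variables `x_c`. -/
def generic : D.Formal r :=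
  Sum.elim (fun j => SuperPoly.X (D.vpar r) (Sum.inl j))
    (fun j => if h : D.pos j ∈ S.filt r then SuperPoly.X (D.vpar r) (Sum.inr ⟨j, h⟩) else 0)

/-- `L = L₀ + ∑_c x_c ς_c` -/
def lax (L₀ : A) : D.Formal r := D.emb r L₀ + D.generic r

open Classical in
/-- The differential `ς_(f)` of `f = f_0 + f_1`: its coefficient at `ς_j` is
`(-1)^i ∂_{-j} f_0 + ∂_{-j} f_1`, and its coefficient at `ς_{-j}` is `∂_j f_0 + (-1)^i ∂_j f_1` if
`x_j` is one of the variables and `0` if not, `i` being the parity of `j`. -/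
def differential (f : D.Poly r) : D.Formal r :=
  Sum.elim
    (fun j => if h : D.pos j ∈ S.filt r then
        SuperPoly.pd (D.vpar r) (Sum.inr ⟨j, h⟩) (SuperPoly.comp (D.vpar r) 0 f) +
          sgn F (D.par j) •
            SuperPoly.pd (D.vpar r) (Sum.inr ⟨j, h⟩) (SuperPoly.comp (D.vpar r) 1 f)
      else 0)
    (fun j => sgn F (D.par j) •
        SuperPoly.pd (D.vpar r) (Sum.inl j) (SuperPoly.comp (D.vpar r) 0 f) +
      SuperPoly.pd (D.vpar r) (Sum.inl j) (SuperPoly.comp (D.vpar r) 1 f))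

/-- The linear bracket
`{f, g}_1 = ⟨L, [ς_(f), (κ ς_(g))_+] - [(κ ς_(f))_-, ς_(g)]⟩`. -/
def bracket₁ (L₀ κ : A) (f g : D.Poly r) : D.Poly r :=
  D.pairing r (D.lax r L₀)
    (D.commutator r (D.differential r f)
        (D.plus r (D.mul r (D.emb r κ) (D.differential r g))) -
      D.commutator r (D.minus r (D.mul r (D.emb r κ) (D.differential r f)))
        (D.differential r g))

/-- The quadratic bracket
`{f, g}_2 = ⟨(L ς_(f))_- L - L (ς_(f) L)_-, ς_(g)⟩`. -/
def bracket₂ (L₀ : A) (f g : D.Poly r) : D.Poly r :=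
  D.pairing r
    (D.mul r (D.minus r (D.mul r (D.lax r L₀) (D.differential r f))) (D.lax r L₀) -
      D.mul r (D.lax r L₀) (D.minus r (D.mul r (D.differential r f) (D.lax r L₀))))
    (D.differential r g)

end DualBases

/-! ### The product of `𝒢̄` is well defined -/

section WellDefined

variable (S : PolarizedAlgebra F A)

theorem mem_neg_of_form {x : A} (h : ∀ n ∈ S.neg, S.form n x = 0) : x ∈ S.neg := by
  obtain ⟨p, hp, n, hn, rfl⟩ : ∃ p ∈ S.pos.toSubmodule, ∃ n ∈ S.neg.toSubmodule, p + n = x :=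
    Submodule.mem_sup.1 (S.polarization.sup_eq_top ▸ Submodule.mem_top)
  have h0 : p = 0 := by
    refine S.form_nondegenerate.2 p fun y => ?_
    obtain ⟨p', hp', n', hn', rfl⟩ :
        ∃ p ∈ S.pos.toSubmodule, ∃ n ∈ S.neg.toSubmodule, p + n = y :=
      Submodule.mem_sup.1 (S.polarization.sup_eq_top ▸ Submodule.mem_top)
    have h1 := h n' hn'
    rw [map_add, S.neg_isotropic hn' hn, add_zero] at h1
    rw [map_add, LinearMap.add_apply, S.pos_isotropic hp' hp, h1, add_zero]
  rw [h0, zero_add]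
  exact hn

/-- `A^(m-1)`, where `A^(-1)` is replaced by `0`. -/
def filtPred : ℕ → Submodule F A
  | 0 => ⊥
  | m + 1 => S.filt m

theorem filt_eq (m : ℕ) : S.filt m = S.filtStep (S.filtPred m) := by
  cases m <;> rfl

/-- The subspaces `A^(m)` are also those obtained by multiplication from the right. -/
theorem mul_mem_of_mem_filt (m : ℕ) : ∀ u ∈ S.filt m, ∀ a ∈ S.neg,
    u * a ∈ S.filtPred m ⊔ S.neg.toSubmodule := by
  induction m with
  | zero =>
    intro u hu a ha
    have h : u * a ∈ S.neg := S.mem_neg_of_form fun n hn => by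
      rw [← S.form_assoc]
      have := hu.2 n hn
      rw [bot_sup_eq] at this
      exact S.neg_isotropic this ha
    exact Submodule.mem_sup_right h
  | succ m ih =>
    intro u hu a ha
    obtain ⟨p, hp, n, hn, h⟩ :
        ∃ p ∈ S.pos.toSubmodule, ∃ n ∈ S.neg.toSubmodule, p + n = u * a :=
      Submodule.mem_sup.1 (S.polarization.sup_eq_top ▸ Submodule.mem_top)
    rw [← h]
    refine add_mem (Submodule.mem_sup_left ?_) (Submodule.mem_sup_right hn)
    change p ∈ S.filt m
    rw [filt_eq]
    refine ⟨hp, fun b hb => ?_⟩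
    have h1 : b * p = b * u * a - b * n := by rw [mul_assoc, ← h, mul_add, add_sub_cancel_right]
    rw [h1]
    refine sub_mem ?_ (Submodule.mem_sup_right (S.neg.mul_mem hb hn))
    obtain ⟨w, hw, n', hn', h2⟩ := Submodule.mem_sup.1 (hu.2 b hb)
    rw [← h2, add_mul]
    exact add_mem (ih w hw a ha) (Submodule.mem_sup_right (S.neg.mul_mem hn' ha))

namespace DualBases

variable {S} {J : Type*} (D : S.DualBases J)

/-- An element of `A` involves only finitely many of the `ς_j`. -/
theorem finite_coeff (x : A) :
    {j | S.form (D.neg j) x ≠ 0}.Finite := by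
  obtain ⟨p, hp, n, hn, rfl⟩ : ∃ p ∈ S.pos.toSubmodule, ∃ n ∈ S.neg.toSubmodule, p + n = x :=
    Submodule.mem_sup.1 (S.polarization.sup_eq_top ▸ Submodule.mem_top)
  have h : ∀ j, S.form (D.neg j) (p + n) = S.form (D.neg j) p := fun j => by
    rw [map_add, S.neg_isotropic (D.neg_mem j).1 hn, add_zero]
  simp only [h]
  clear h
  rw [← D.span_eq] at hp
  induction hp using Submodule.span_induction with
  | mem x hx =>
    obtain ⟨k, rfl⟩ := hx
    refine (Set.finite_singleton k).subset fun j hj => ?_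
    by_contra hjk
    exact hj (D.dual_ne j k hjk)
  | zero => simp
  | add x y _ _ hx hy =>
    refine (hx.union hy).subset fun j hj => ?_
    by_contra hc
    simp only [Set.mem_union, Set.mem_ofPred_eq, not_or, not_not] at hc
    exact hj (by rw [map_add, hc.1, hc.2, add_zero])
  | smul c x _ hx =>
    refine hx.subset fun j hj hc => hj ?_
    rw [map_smul, hc, smul_zero]

theorem form_comm_eq_zero (S : PolarizedAlgebra F A) {i j : ZMod 2} {a b : A} (ha : a ∈ S.gr i)
    (hb : b ∈ S.gr j) (h : S.form b a = 0) : S.form a b = 0 := by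
  rw [S.form_symm ha hb, h, mul_zero]

theorem mem_neg_of_coeff {x : A} (h : ∀ k, S.form (D.neg k) x = 0) : x ∈ S.neg := by
  obtain ⟨p, hp, n, hn, rfl⟩ : ∃ p ∈ S.pos.toSubmodule, ∃ n ∈ S.neg.toSubmodule, p + n = x :=
    Submodule.mem_sup.1 (S.polarization.sup_eq_top ▸ Submodule.mem_top)
  rw [← D.span_eq] at hp
  obtain ⟨c, rfl⟩ := Finsupp.mem_span_range_iff_exists_finsupp.1 hp
  have hc : c = 0 := by
    ext k
    have h1 := h k
    rw [map_add, S.neg_isotropic (D.neg_mem k).1 hn, add_zero, Finsupp.sum, map_sum,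
      Finset.sum_eq_single k] at h1
    · rw [map_smul, D.dual_self, smul_eq_mul, mul_one] at h1
      exact h1
    · intro j _ hj
      rw [map_smul, D.dual_ne k j hj.symm, smul_zero]
    · intro hk
      rw [Finsupp.notMem_support_iff.1 hk, zero_smul, map_zero]
  rw [hc, Finsupp.sum_zero_index, zero_add]
  exact hn

theorem finite_filtPred (hS : S.IsSemiFinitelyFiltered) (m : ℕ) :
    {j | D.pos j ∈ S.filtPred m}.Finite := by
  have hfd : FiniteDimensional F (S.filtPred m) := by
    cases m with
    | zero => exact inferInstanceAs (FiniteDimensional F (⊥ : Submodule F A))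
    | succ m => exact hS.finiteDimensional m
  have h1 : LinearIndependent F
      (fun j : {j | D.pos j ∈ S.filtPred m} => (⟨D.pos j, j.2⟩ : S.filtPred m)) := by
    refine LinearIndependent.of_comp (S.filtPred m).subtype ?_
    exact D.linearIndependent.comp _ Subtype.val_injective
  exact Set.finite_coe_iff.1 h1.finite

theorem form_filtPred {m : ℕ} {w : A} (hw : w ∈ S.filtPred m) {j : J}
    (hj : D.pos j ∉ S.filtPred m) : S.form w (D.neg j) = 0 := by
  cases m with
  | zero => rw [(Submodule.mem_bot F).1 hw, map_zero, LinearMap.zero_apply]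
  | succ m =>
    change w ∈ S.filt m at hw
    rw [← D.adapted m] at hw
    induction hw using Submodule.span_induction with
    | mem x hx =>
      obtain ⟨hx, k, rfl⟩ := hx
      refine form_comm_eq_zero S (D.pos_mem k).2 (D.neg_mem j).2 (D.dual_ne j k ?_)
      rintro rfl
      exact hj hx
    | zero => simp
    | add x y _ _ hx hy => rw [map_add, LinearMap.add_apply, hx, hy, add_zero]
    | smul c x _ hx => rw [map_smul, LinearMap.smul_apply, hx, smul_zero]

theorem finite_left (hS : S.IsSemiFinitelyFiltered) (b : J) :
    {i | ∃ k, S.form (D.neg k) (D.neg i * D.pos b) ≠ 0}.Finite := by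
  obtain ⟨m, hm⟩ := hS.exhaustive _ (D.pos_mem b).1
  refine (D.finite_filtPred hS m).subset fun i ⟨k, hk⟩ => ?_
  by_contra hi
  refine hk ?_
  rw [← S.form_assoc]
  refine form_comm_eq_zero S (S.gr_mul (D.neg_mem k).2 (D.neg_mem i).2) (D.pos_mem b).2 ?_
  rw [← S.form_assoc]
  obtain ⟨w, hw, n, hn, h⟩ :=
    Submodule.mem_sup.1 (S.mul_mem_of_mem_filt m _ hm _ (D.neg_mem k).1)
  rw [← h, map_add, LinearMap.add_apply, D.form_filtPred hw hi,
    S.neg_isotropic hn (D.neg_mem i).1, add_zero]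

theorem finite_right (hS : S.IsSemiFinitelyFiltered) (b : J) :
    {i | ∃ k, S.form (D.neg k) (D.pos b * D.neg i) ≠ 0}.Finite := by
  obtain ⟨m, hm⟩ := hS.exhaustive _ (D.pos_mem b).1
  refine (D.finite_filtPred hS m).subset fun i ⟨k, hk⟩ => ?_
  by_contra hi
  refine hk ?_
  rw [← S.form_assoc]
  rw [filt_eq] at hm
  obtain ⟨w, hw, n, hn, h⟩ := Submodule.mem_sup.1 (hm.2 _ (D.neg_mem k).1)
  rw [← h, map_add, LinearMap.add_apply, D.form_filtPred hw hi,
    S.neg_isotropic hn (D.neg_mem i).1, add_zero]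

/-- The pairs of indices which contribute to the part of `ς_ξ ς_η` in the `ς_j`. -/
theorem finite_pairs (hS : S.IsSemiFinitelyFiltered) (r : ℕ) {u v : D.Formal r}
    (hu : u ∈ D.Gbar r) (hv : v ∈ D.Gbar r) :
    {p : D.Idx × D.Idx | u p.1 ≠ 0 ∧ v p.2 ≠ 0 ∧
      ∃ k, S.form (D.neg k) (D.elt p.1 * D.elt p.2) ≠ 0}.Finite := by
  have hu' : {j : J | u (Sum.inr j) ≠ 0}.Finite := hu
  have hv' : {j : J | v (Sum.inr j) ≠ 0}.Finite := hv
  refine (((hu'.prod hv').image (Prod.map Sum.inr Sum.inr)).union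
    (((hv'.biUnion fun b _ => (D.finite_left hS b).prod (Set.finite_singleton b)).image
      (Prod.map Sum.inl Sum.inr)).union
    ((hu'.biUnion fun b _ => (Set.finite_singleton b).prod (D.finite_right hS b)).image
      (Prod.map Sum.inr Sum.inl)))).subset ?_
  rintro ⟨a | a, b | b⟩ ⟨ha, hb, k, hk⟩
  · exact absurd (S.neg_isotropic (D.neg_mem k).1
      (S.neg.mul_mem (D.neg_mem a).1 (D.neg_mem b).1)) hk
  · refine Or.inr (Or.inl ⟨(a, b), ?_, rfl⟩)
    simp only [Set.mem_iUnion]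
    exact ⟨b, hb, ⟨k, hk⟩, rfl⟩
  · refine Or.inr (Or.inr ⟨(a, b), ?_, rfl⟩)
    simp only [Set.mem_iUnion]
    exact ⟨a, ha, rfl, ⟨k, hk⟩⟩
  · exact Or.inl ⟨(a, b), ⟨ha, hb⟩, rfl⟩

/-- The sum which defines a coefficient of a product in `𝒢̄` has finitely many nonzero terms. -/
theorem mul_support_finite (hS : S.IsSemiFinitelyFiltered) (r : ℕ) {u v : D.Formal r}
    (hu : u ∈ D.Gbar r) (hv : v ∈ D.Gbar r) (c : D.Idx) :
    (Function.support fun p : D.Idx × D.Idx => D.coeff (D.elt p.1 * D.elt p.2) c •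
      (u p.1 * SuperPoly.twist (D.vpar r) (D.ipar p.1) (v p.2))).Finite := by
  have key : ∀ p : D.Idx × D.Idx, D.coeff (D.elt p.1 * D.elt p.2) c •
      (u p.1 * SuperPoly.twist (D.vpar r) (D.ipar p.1) (v p.2)) ≠ 0 →
      D.coeff (D.elt p.1 * D.elt p.2) c ≠ 0 ∧ u p.1 ≠ 0 ∧ v p.2 ≠ 0 := by
    intro p hp
    refine ⟨fun h => hp ?_, fun h => hp ?_, fun h => hp ?_⟩
    · rw [h, zero_smul]
    · rw [h, zero_mul, smul_zero]
    · rw [h, map_zero, mul_zero, smul_zero]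
  rcases c with l | l
  · have hu' : {j : J | u (Sum.inr j) ≠ 0}.Finite := hu
    have hv' : {j : J | v (Sum.inr j) ≠ 0}.Finite := hv
    refine (((hu'.prod hv').image (Prod.map Sum.inr Sum.inr)).union
      ((((D.finite_left hS l).biUnion fun b _ =>
          (D.finite_coeff (D.neg b * D.pos l)).prod (Set.finite_singleton b)).image
          (Prod.map Sum.inl Sum.inl)).union
      (((hv'.biUnion fun b _ => (D.finite_coeff (D.pos b * D.pos l)).prod
          (Set.finite_singleton b)).image (Prod.map Sum.inl Sum.inr)).union
        ((hu'.biUnion fun b _ => (Set.finite_singleton b).prod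
          (D.finite_coeff (D.pos l * D.pos b))).image (Prod.map Sum.inr Sum.inl))))).subset ?_
    rintro ⟨a | a, b | b⟩ hp
    all_goals
      obtain ⟨hc, ha, hb⟩ := key _ hp
      change S.form _ (D.pos l) ≠ 0 at hc
    · have hc' : S.form (D.neg a) (D.neg b * D.pos l) ≠ 0 := by rw [← S.form_assoc]; exact hc
      refine Or.inr (Or.inl ⟨(a, b), ?_, rfl⟩)
      simp only [Set.mem_iUnion]
      refine ⟨b, ?_, hc', rfl⟩
      by_contra h
      refine hc' (S.neg_isotropic (D.neg_mem a).1 (D.mem_neg_of_coeff fun k => ?_))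
      by_contra hk
      exact h ⟨k, hk⟩
    · have hc' : S.form (D.neg a) (D.pos b * D.pos l) ≠ 0 := by rw [← S.form_assoc]; exact hc
      refine Or.inr (Or.inr (Or.inl ⟨(a, b), ?_, rfl⟩))
      simp only [Set.mem_iUnion]
      exact ⟨b, hb, hc', rfl⟩
    · refine Or.inr (Or.inr (Or.inr ⟨(a, b), ?_, rfl⟩))
      simp only [Set.mem_iUnion]
      refine ⟨a, ha, rfl, fun h => hc ?_⟩
      refine form_comm_eq_zero S (S.gr_mul (D.pos_mem a).2 (D.neg_mem b).2) (D.pos_mem l).2 ?_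
      change S.form (D.pos l) (D.pos a * D.neg b) = 0
      rw [← S.form_assoc]
      exact form_comm_eq_zero S (S.gr_mul (D.pos_mem l).2 (D.pos_mem a).2) (D.neg_mem b).2 h
    · exact Or.inl ⟨(a, b), ⟨ha, hb⟩, rfl⟩
  · refine (D.finite_pairs hS r hu hv).subset fun p hp => ?_
    obtain ⟨hc, ha, hb⟩ := key _ hp
    exact ⟨ha, hb, l, hc⟩

/-- `𝒢̄` is closed under the product. -/
theorem mul_mem_Gbar (hS : S.IsSemiFinitelyFiltered) (r : ℕ) {u v : D.Formal r}
    (hu : u ∈ D.Gbar r) (hv : v ∈ D.Gbar r) : D.mul r u v ∈ D.Gbar r := by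
  refine ((D.finite_pairs hS r hu hv).biUnion fun p _ =>
    D.finite_coeff (D.elt p.1 * D.elt p.2)).subset fun l hl => ?_
  obtain ⟨p, hp⟩ : ∃ p : D.Idx × D.Idx, D.coeff (D.elt p.1 * D.elt p.2) (Sum.inr l) •
      (u p.1 * SuperPoly.twist (D.vpar r) (D.ipar p.1) (v p.2)) ≠ 0 := by
    by_contra! h
    exact hl (finsum_eq_zero_of_forall_eq_zero h)
  have hc : S.form (D.neg l) (D.elt p.1 * D.elt p.2) ≠ 0 := fun h => hp (by
    change S.form (D.neg l) (D.elt p.1 * D.elt p.2) • _ = _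
    rw [h, zero_smul])
  simp only [Set.mem_iUnion]
  refine ⟨p, ⟨fun h => hp ?_, fun h => hp ?_, l, hc⟩, hc⟩
  · rw [h, zero_mul, smul_zero]
  · rw [h, map_zero, mul_zero, smul_zero]

end DualBases
end WellDefined

end PolarizedAlgebra

end PoissonSuper

end

/-!
The formal sums `𝒢̄` are an associative superalgebra with an associative, supersymmetric,
nondegenerate `𝒫`-valued form, and they are the sum of two isotropic subalgebras (`splitting`). The
form is compared with that of `A` by expanding both in the dual bases; that the product is
associative then follows from nondegeneracy, since associativity at `u, v, w` is implied by
associativity at `v, w, ς_c` for all `c`, and so eventually by associativity in `A`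
(`mul_assoc_Gbar`).

In terms of the Hamiltonian vector field `V_X = (L X)_- L - L (X L)_-` (`Splitting.field`) the
second bracket is `{f, g}_2 = ⟨V_{ς_(f)}, ς_(g)⟩`. Invariance of the form makes it skew
(`Splitting.form_field_skew`). The differential `ς_(g)` is made so that `g ↦ ⟨V, ς_(g)⟩` is the
superderivation of `𝒫` with `x_c ↦ V_c` (`isSuperderivation_form`, `form_diff_X`). Since a negative
element lowers the filtration degree, `V_X` has coefficients only at those indices which carry a
variable, and therefore this superderivation maps `L` to `V_X` (`mapCoeff_laxElt`): it is
tangent to the space of all `L`.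

Skew biderivations need to satisfy the Jacobi identity only at the variables
(`SuperPoly.jacobi_of_X`). Differentials of variables have constant coefficients, so there an
iterated bracket involves only the derivative of `V_X` in `L` (`quadratic_quadratic_X`), and the Jacobi
identity says that the supercommutator of `V_X` and `V_Y` is `V_Z`, where `Z` is the gradient in `L`
of `⟨V_X, Y⟩` (`Splitting.fieldDeriv_sub_fieldDeriv`, `Splitting.form_fieldDeriv`). This is a formal
consequence of the Rota–Baxter identity for `u ↦ u_-` (`Splitting.minus_mul`).

The element `L₀` is arbitrary in all of this. As `κ` is central, replacing `L₀` by `L₀ + t κ`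
changes `{·,·}_2` into `{·,·}_2 + t {·,·}_1` (`bracket₂_add_smul`), which is thus a Poisson superbracket for
every `t`. The Jacobiator of `a {·,·}_1 + b {·,·}_2` is a quadratic form in `(a, b)` vanishing at
`(0, 1)`, `(1, 1)` and `(-1, 1)`, and hence zero in characteristic different from `2`
(`isPoissonSuperpair_of_pencil`).
-/

noncomputable section

namespace PoissonSuper

/-! ### Signs -/

section Sign

variable {F : Type*} [Field F]

@[simp]
theorem sgn_zero : sgn F 0 = 1 := if_pos rfl

@[simp]
theorem sgn_one : sgn F 1 = -1 := if_neg one_ne_zero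

theorem parity_cases (i : ZMod 2) : i = 0 ∨ i = 1 := by
  revert i
  decide

theorem sgn_add (i j : ZMod 2) : sgn F (i + j) = sgn F i * sgn F j := by
  rcases parity_cases i with rfl | rfl <;> rcases parity_cases j with rfl | rfl <;>
    simp [CharTwo.add_self_eq_zero]

@[simp]
theorem sgn_mul_self (i : ZMod 2) : sgn F i * sgn F i = 1 := by
  rcases parity_cases i with rfl | rfl <;> simp

end Sign

/-! ### Supersymmetric polynomials -/

namespace SuperPoly

section Exterior

variable {F : Type*} [Field F] {M : Type*} [AddCommGroup M] [Module F M]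

local notation "Λ" => ExteriorAlgebra F M
local notation "eo" => CliffordAlgebra.evenOdd (0 : QuadraticForm F M)

theorem ι_mul_eq_involute_mul (m : M) (z : Λ) :
    ExteriorAlgebra.ι F m * z = CliffordAlgebra.involute z * ExteriorAlgebra.ι F m := by
  induction z using CliffordAlgebra.left_induction with
  | algebraMap r => rw [AlgHom.commutes, Algebra.commutes]
  | add x y hx hy => rw [mul_add, map_add, add_mul, hx, hy]
  | ι_mul x n hx =>
    have h := eq_neg_of_add_eq_zero_left (ExteriorAlgebra.ι_add_mul_swap (R := F) m n)
    change ExteriorAlgebra.ι F m * (ExteriorAlgebra.ι F n * x) =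
      CliffordAlgebra.involute (ExteriorAlgebra.ι F n * x) * ExteriorAlgebra.ι F m
    have hn : CliffordAlgebra.involute (ExteriorAlgebra.ι F n) = -ExteriorAlgebra.ι F n :=
      CliffordAlgebra.involute_ι n
    rw [map_mul, hn, ← mul_assoc, h, neg_mul, neg_mul, neg_mul, mul_assoc, hx, mul_assoc]

theorem mul_eq_of_mem_even {w : Λ} (hw : w ∈ eo 0) (z : Λ) : w * z = z * w := by
  induction w, hw using CliffordAlgebra.even_induction with
  | algebraMap r => exact Algebra.commutes r z
  | add x y _ _ hx hy => rw [add_mul, mul_add, hx, hy]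
  | ι_mul_ι_mul m₁ m₂ x _ hx =>
    have h := fun m z => ι_mul_eq_involute_mul (F := F) (M := M) m z
    change ExteriorAlgebra.ι F m₁ * ExteriorAlgebra.ι F m₂ * x * z =
      z * (ExteriorAlgebra.ι F m₁ * ExteriorAlgebra.ι F m₂ * x)
    rw [mul_assoc, hx, ← mul_assoc, mul_assoc _ _ z, h m₂ z, ← mul_assoc, h m₁,
      CliffordAlgebra.involute_involute, mul_assoc, mul_assoc, mul_assoc]

theorem mul_eq_of_mem_odd {w : Λ} (hw : w ∈ eo 1) (z : Λ) :
    w * z = CliffordAlgebra.involute z * w := by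
  induction w, hw using CliffordAlgebra.odd_induction with
  | ι m => exact ι_mul_eq_involute_mul m z
  | add x y _ _ hx hy => rw [add_mul, mul_add, hx, hy]
  | ι_mul_ι_mul m₁ m₂ x _ hx =>
    have h := fun m z => ι_mul_eq_involute_mul (F := F) (M := M) m z
    change ExteriorAlgebra.ι F m₁ * ExteriorAlgebra.ι F m₂ * x * z =
      _ * (ExteriorAlgebra.ι F m₁ * ExteriorAlgebra.ι F m₂ * x)
    rw [mul_assoc, hx, ← mul_assoc, mul_assoc _ _ (CliffordAlgebra.involute z), h m₂,
      ← mul_assoc, h m₁, CliffordAlgebra.involute_involute, mul_assoc, mul_assoc, mul_assoc]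

/-- Contraction with a functional is an odd map of the exterior algebra. -/
theorem contractLeft_mem (d : Module.Dual F M) {i : ZMod 2} {w : Λ} (hw : w ∈ eo i) :
    CliffordAlgebra.contractLeft d w ∈ eo (i + 1) := by
  have step : ∀ (j : ZMod 2) (m : M) (y : Λ), y ∈ eo j →
      CliffordAlgebra.contractLeft d y ∈ eo (j + 1) →
      CliffordAlgebra.contractLeft d (CliffordAlgebra.ι _ m * y) ∈ eo (1 + j + 1) := by
    intro j m y hy hdy
    rw [CliffordAlgebra.contractLeft_ι_mul]
    refine sub_mem (Submodule.smul_mem _ _ ?_) ?_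
    · have : 1 + j + 1 = j := by linear_combination (CharTwo.two_eq_zero (R := ZMod 2))
      rwa [this]
    · rw [add_assoc]
      exact SetLike.mul_mem_graded (CliffordAlgebra.ι_mem_evenOdd_one _ m) hdy
  have step2 : ∀ (j : ZMod 2) (m₁ m₂ : M) (y : Λ), y ∈ eo j →
      CliffordAlgebra.contractLeft d y ∈ eo (j + 1) →
      CliffordAlgebra.contractLeft d (CliffordAlgebra.ι _ m₁ * CliffordAlgebra.ι _ m₂ * y) ∈
        eo (j + 1) := by
    intro j m₁ m₂ y hy hdy
    have h := step _ m₁ _ (SetLike.mul_mem_graded (CliffordAlgebra.ι_mem_evenOdd_one _ m₂) hy)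
      (step j m₂ y hy hdy)
    have : 1 + (1 + j) + 1 = j + 1 := by linear_combination (CharTwo.two_eq_zero (R := ZMod 2))
    rwa [this, ← mul_assoc] at h
  rcases parity_cases i with rfl | rfl
  · induction w, hw using CliffordAlgebra.even_induction with
    | algebraMap r => rw [CliffordAlgebra.contractLeft_algebraMap]; exact zero_mem _
    | add x y _ _ hx hy => rw [map_add]; exact add_mem hx hy
    | ι_mul_ι_mul m₁ m₂ x hx h => exact step2 0 m₁ m₂ x hx h
  · induction w, hw using CliffordAlgebra.odd_induction with
    | ι m =>
      rw [CliffordAlgebra.contractLeft_ι]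
      exact SetLike.algebraMap_mem_graded eo _
    | add x y _ _ hx hy => rw [map_add]; exact add_mem hx hy
    | ι_mul_ι_mul m₁ m₂ x hx h => exact step2 1 m₁ m₂ x hx h

end Exterior

variable {F : Type*} [Field F] {V : Type*} {par : V → ZMod 2}

theorem tmul_mem_part {i : ZMod 2} (p : MvPolynomial {v : V // par v = 0} F)
    {w : ExteriorAlgebra F ({v : V // par v ≠ 0} →₀ F)}
    (hw : w ∈ CliffordAlgebra.evenOdd (0 : QuadraticForm F ({v : V // par v ≠ 0} →₀ F)) i) :
    (p ⊗ₜ[F] w : SuperPoly F par) ∈ part par i :=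
  ⟨p ⊗ₜ ⟨w, hw⟩, rfl⟩

@[elab_as_elim]
theorem part_induction {i : ZMod 2} {motive : ∀ f : SuperPoly F par, f ∈ part par i → Prop}
    (zero : motive 0 (zero_mem _))
    (add : ∀ f g hf hg, motive f hf → motive g hg → motive (f + g) (add_mem hf hg))
    (tmul : ∀ (p : MvPolynomial {v : V // par v = 0} F)
      (w : ExteriorAlgebra F ({v : V // par v ≠ 0} →₀ F))
      (hw : w ∈ CliffordAlgebra.evenOdd (0 : QuadraticForm F ({v : V // par v ≠ 0} →₀ F)) i),
        motive (p ⊗ₜ[F] w) (tmul_mem_part p hw)) {f : SuperPoly F par} (hf : f ∈ part par i) :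
    motive f hf := by
  obtain ⟨t, ht⟩ := id hf
  induction t using TensorProduct.induction_on generalizing f with
  | zero =>
    rw [map_zero] at ht
    subst ht
    exact zero
  | add x y hx hy =>
    rw [map_add] at ht
    subst ht
    exact add _ _ ⟨x, rfl⟩ ⟨y, rfl⟩ (hx _ rfl) (hy _ rfl)
  | tmul p w =>
    subst ht
    exact tmul p w w.2

theorem comp_of_mem {i : ZMod 2} {f : SuperPoly F par} (hf : f ∈ part par i) (j : ZMod 2) :
    comp par j f = if i = j then f else 0 := by
  induction hf using part_induction with
  | zero => simp
  | add f g _ _ hf hg => rw [map_add, hf, hg]; split_ifs <;> simp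
  | tmul p w hw => exact comp_eq par i p w hw j

theorem comp_mem (i : ZMod 2) (f : SuperPoly F par) : comp par i f ∈ part par i := by
  induction f using TensorProduct.induction_on with
  | zero => rw [map_zero]; exact zero_mem _
  | add x y hx hy => rw [map_add]; exact add_mem hx hy
  | tmul p w => exact tmul_mem_part p (SetLike.coe_mem _)

theorem comp_add_comp (f : SuperPoly F par) : comp par 0 f + comp par 1 f = f := by
  have h := twist_tmul (F := F) par 0
  induction f using TensorProduct.induction_on with
  | zero => simp
  | add x y hx hy => rw [map_add, map_add, add_add_add_comm, hx, hy]
  | tmul p w => simpa [twist] using h p w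

theorem exists_add_of_part (f : SuperPoly F par) :
    ∃ f₀ ∈ part par 0, ∃ f₁ ∈ part par 1, f = f₀ + f₁ :=
  ⟨_, comp_mem 0 f, _, comp_mem 1 f, (comp_add_comp f).symm⟩

theorem part_isCompl : IsCompl (part (F := F) par 0) (part par 1) := by
  refine IsCompl.of_eq ((Submodule.eq_bot_iff _).2 fun f hf => ?_)
    ((Submodule.eq_top_iff'.2 fun f => ?_))
  · have h := comp_of_mem hf.1 0
    rw [comp_of_mem hf.2 0] at h
    simpa using h.symm
  · rw [← comp_add_comp f]
    exact Submodule.add_mem_sup (comp_mem 0 f) (comp_mem 1 f)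

theorem twist_of_mem (i : ZMod 2) {j : ZMod 2} {f : SuperPoly F par} (hf : f ∈ part par j) :
    twist par i f = sgn F (i * j) • f := by
  simp only [twist, LinearMap.add_apply, LinearMap.smul_apply, comp_of_mem hf]
  rcases parity_cases j with rfl | rfl <;> simp

theorem twist_mul (i : ZMod 2) (f g : SuperPoly F par) :
    twist par i (f * g) = twist par i f * twist par i g := by
  induction f using TensorProduct.induction_on with
  | zero => simp
  | add x y hx hy => simp only [add_mul, map_add, hx, hy]
  | tmul p a =>
  induction g using TensorProduct.induction_on with
  | zero => simp
  | add x y hx hy => simp only [mul_add, map_add, hx, hy]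
  | tmul q b =>
    rw [Algebra.TensorProduct.tmul_mul_tmul, twist_tmul, twist_tmul, twist_tmul]
    split_ifs <;> simp

theorem twist_mem (i : ZMod 2) {j : ZMod 2} {f : SuperPoly F par} (hf : f ∈ part par j) :
    twist par i f ∈ part par j := by
  rw [twist_of_mem i hf]
  exact Submodule.smul_mem _ _ hf

theorem twist_twist (i j : ZMod 2) (f : SuperPoly F par) :
    twist par i (twist par j f) = twist par (i + j) f := by
  obtain ⟨f₀, h₀, f₁, h₁, rfl⟩ := exists_add_of_part f
  simp only [map_add, twist_of_mem _ h₀, twist_of_mem _ h₁, map_smul, smul_smul, ← sgn_add]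
  ring_nf

theorem one_mem_part : (1 : SuperPoly F par) ∈ part par 0 := by
  rw [Algebra.TensorProduct.one_def]
  exact tmul_mem_part _ (SetLike.one_mem_graded _)

theorem algebraMap_mem_part (c : F) : algebraMap F (SuperPoly F par) c ∈ part par 0 := by
  rw [Algebra.algebraMap_eq_smul_one]
  exact Submodule.smul_mem _ _ one_mem_part

@[simp]
theorem twist_one (i : ZMod 2) : twist par i (1 : SuperPoly F par) = 1 := by
  rw [twist_of_mem i one_mem_part, mul_zero, sgn_zero, one_smul]

theorem mul_mem_part {i j : ZMod 2} {f g : SuperPoly F par} (hf : f ∈ part par i)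
    (hg : g ∈ part par j) : f * g ∈ part par (i + j) := by
  induction hf using part_induction with
  | zero => rw [zero_mul]; exact zero_mem _
  | add x y _ _ hx hy => rw [add_mul]; exact add_mem hx hy
  | tmul p a ha =>
  induction hg using part_induction with
  | zero => rw [mul_zero]; exact zero_mem _
  | add x y _ _ hx hy => rw [mul_add]; exact add_mem hx hy
  | tmul q b hb =>
    rw [Algebra.TensorProduct.tmul_mul_tmul]
    exact tmul_mem_part _ (SetLike.mul_mem_graded ha hb)

/-- Supercommutativity: moving a homogeneous `f` past `g` twists `g`. -/
theorem mul_eq_twist_mul {i : ZMod 2} {f : SuperPoly F par} (hf : f ∈ part par i)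
    (g : SuperPoly F par) : f * g = twist par i g * f := by
  induction hf using part_induction with
  | zero => simp
  | add x y _ _ hx hy => rw [add_mul, mul_add, hx, hy]
  | tmul p a ha =>
  induction g using TensorProduct.induction_on with
  | zero => simp
  | add x y hx hy => simp only [mul_add, map_add, add_mul, hx, hy]
  | tmul q b =>
    rw [twist_tmul, Algebra.TensorProduct.tmul_mul_tmul, Algebra.TensorProduct.tmul_mul_tmul,
      mul_comm]
    rcases parity_cases i with rfl | rfl
    · rw [if_pos rfl, mul_eq_of_mem_even ha]
    · rw [if_neg one_ne_zero, mul_eq_of_mem_odd ha]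

theorem mul_comm_of_mem {i j : ZMod 2} {f g : SuperPoly F par} (hf : f ∈ part par i)
    (hg : g ∈ part par j) : f * g = sgn F (i * j) • (g * f) := by
  rw [mul_eq_twist_mul hf, twist_of_mem i hg, smul_mul_assoc]

theorem isSuperCommutative : IsSuperCommutative (part (F := F) par) where
  isCompl := part_isCompl
  one_mem := one_mem_part
  mul_mem := mul_mem_part
  comm := mul_comm_of_mem

theorem X_mem_part (v : V) : (X par v : SuperPoly F par) ∈ part par (par v) := by
  by_cases h : par v = 0
  · simp only [X, h, dite_true]
    exact tmul_mem_part _ (SetLike.one_mem_graded _)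
  · have h1 : par v = 1 := (parity_cases _).resolve_left h
    rw [X, dif_neg h, h1]
    exact tmul_mem_part _ (CliffordAlgebra.ι_mem_evenOdd_one _ _)

theorem adjoin_range_X :
    Algebra.adjoin F (Set.range (X par : V → SuperPoly F par)) = ⊤ := by
  set S := Algebra.adjoin F (Set.range (X par : V → SuperPoly F par)) with hS
  have hl : ∀ p : MvPolynomial {v : V // par v = 0} F, (p ⊗ₜ[F] 1 : SuperPoly F par) ∈ S := by
    intro p
    induction p using MvPolynomial.induction_on with
    | C a =>
      exact S.algebraMap_mem a
    | add p q hp hq => rw [TensorProduct.add_tmul]; exact add_mem hp hq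
    | mul_X p v hp =>
      have h : (MvPolynomial.X v ⊗ₜ[F] 1 : SuperPoly F par) = X par v.1 := by
        rw [X, dif_pos v.2]
      have h2 : ((p * MvPolynomial.X v) ⊗ₜ[F] 1 : SuperPoly F par) =
          (p ⊗ₜ[F] 1) * X par v.1 := by
        rw [← h, Algebra.TensorProduct.tmul_mul_tmul, mul_one]
      rw [h2]
      exact mul_mem hp (Algebra.subset_adjoin (Set.mem_range_self _))
  have hr : ∀ w : ExteriorAlgebra F ({v : V // par v ≠ 0} →₀ F),
      (1 ⊗ₜ[F] w : SuperPoly F par) ∈ S := by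
    intro w
    induction w using CliffordAlgebra.left_induction with
    | algebraMap r =>
      rw [Algebra.algebraMap_eq_smul_one, TensorProduct.tmul_smul, ← Algebra.TensorProduct.one_def]
      exact Subalgebra.smul_mem _ (one_mem _) _
    | add x y hx hy => rw [TensorProduct.tmul_add]; exact add_mem hx hy
    | ι_mul x m hx =>
      have h : ∀ m : {v : V // par v ≠ 0} →₀ F,
          (1 ⊗ₜ[F] ExteriorAlgebra.ι F m : SuperPoly F par) ∈ S := by
        intro m
        induction m using Finsupp.induction_linear with
        | zero => rw [map_zero, TensorProduct.tmul_zero]; exact zero_mem _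
        | add x y hx hy => rw [map_add, TensorProduct.tmul_add]; exact add_mem hx hy
        | single v c =>
          have h : (1 ⊗ₜ[F] ExteriorAlgebra.ι F (Finsupp.single v c) : SuperPoly F par) =
              c • X par v.1 := by
            rw [X, dif_neg v.2, ← TensorProduct.tmul_smul, ← map_smul, Finsupp.smul_single,
              smul_eq_mul, mul_one]
          rw [h]
          exact Subalgebra.smul_mem _ (Algebra.subset_adjoin (Set.mem_range_self _)) _
      have h2 : (1 ⊗ₜ[F] (ExteriorAlgebra.ι F m * x) : SuperPoly F par) =
          (1 ⊗ₜ[F] ExteriorAlgebra.ι F m) * (1 ⊗ₜ[F] x) := by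
        rw [Algebra.TensorProduct.tmul_mul_tmul, mul_one]
      exact h2 ▸ mul_mem (h m) hx
  refine Algebra.eq_top_iff.2 fun f => ?_
  induction f using TensorProduct.induction_on with
  | zero => exact zero_mem _
  | add x y hx hy => exact add_mem hx hy
  | tmul p w =>
    have h : (p ⊗ₜ[F] w : SuperPoly F par) = (p ⊗ₜ[F] 1) * (1 ⊗ₜ[F] w) := by
      rw [Algebra.TensorProduct.tmul_mul_tmul, mul_one, one_mul]
    rw [h]
    exact mul_mem (hl p) (hr w)

theorem pd_mem (v : V) {i : ZMod 2} {f : SuperPoly F par} (hf : f ∈ part par i) :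
    pd par v f ∈ part par (i + par v) := by
  induction hf using part_induction with
  | zero => rw [map_zero]; exact zero_mem _
  | add x y _ _ hx hy => rw [map_add]; exact add_mem hx hy
  | tmul p w hw =>
    by_cases h : par v = 0
    · rw [pd, dif_pos h, h, add_zero]
      exact tmul_mem_part _ hw
    · rw [pd, dif_neg h, (parity_cases _).resolve_left h]
      exact tmul_mem_part _ (contractLeft_mem _ hw)

/-- An `F`-linear map `Δ` of parity `p` with the super Leibniz rule
`Δ (f g) = Δ(f) g + (-1)^{pi} f Δ(g)` for `f` of parity `i`. -/
structure IsSuperderivation (p : ZMod 2) (Δ : SuperPoly F par →ₗ[F] SuperPoly F par) : Prop where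
  map_mul : ∀ f g, Δ (f * g) = Δ f * g + twist par p f * Δ g
  map_mem : ∀ {i : ZMod 2} {f : SuperPoly F par}, f ∈ part par i → Δ f ∈ part par (i + p)

theorem isSuperderivation_pd (v : V) :
    IsSuperderivation (par v) (pd par v : SuperPoly F par →ₗ[F] SuperPoly F par) :=
  ⟨pd_mul par v, pd_mem v⟩

namespace IsSuperderivation

variable {p : ZMod 2} {Δ Δ' : SuperPoly F par →ₗ[F] SuperPoly F par}

theorem map_one (h : IsSuperderivation p Δ) : Δ 1 = 0 := by
  have := h.map_mul 1 1
  simpa using this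

theorem map_algebraMap (h : IsSuperderivation p Δ) (c : F) : Δ (algebraMap F _ c) = 0 := by
  rw [Algebra.algebraMap_eq_smul_one, map_smul, h.map_one, smul_zero]

theorem map_twist (h : IsSuperderivation p Δ) (i : ZMod 2) (f : SuperPoly F par) :
    Δ (twist par i f) = sgn F (i * p) • twist par i (Δ f) := by
  obtain ⟨f₀, h₀, f₁, h₁, rfl⟩ := exists_add_of_part f
  simp only [map_add, twist_of_mem i h₀, twist_of_mem i h₁, map_smul,
    twist_of_mem i (h.map_mem h₀), twist_of_mem i (h.map_mem h₁), smul_add, smul_smul]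
  rw [← sgn_add, ← sgn_add]
  congr 3 <;> linear_combination -(i * p) * (CharTwo.two_eq_zero (R := ZMod 2))

/-- A superderivation is determined by its values at the variables. -/
theorem ext_X (h : IsSuperderivation p Δ) (h' : IsSuperderivation p Δ')
    (hX : ∀ v, Δ (X par v) = Δ' (X par v)) : Δ = Δ' := by
  refine LinearMap.ext fun f => ?_
  have hf : f ∈ Algebra.adjoin F (Set.range (X par : V → SuperPoly F par)) := by
    rw [adjoin_range_X]; exact Algebra.mem_top
  induction hf using Algebra.adjoin_induction with
  | mem x hx => obtain ⟨v, rfl⟩ := hx; exact hX v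
  | algebraMap c => rw [h.map_algebraMap, h'.map_algebraMap]
  | add x y _ _ hx hy => rw [map_add, map_add, hx, hy]
  | mul x y _ _ hx hy => rw [h.map_mul, h'.map_mul, hx, hy]

end IsSuperderivation

/-- A polynomial involves only finitely many variables. -/
theorem finite_pd (f : SuperPoly F par) : {v | pd par v f ≠ 0}.Finite := by
  have hf : f ∈ Algebra.adjoin F (Set.range (X par : V → SuperPoly F par)) := by
    rw [adjoin_range_X]; exact Algebra.mem_top
  induction hf using Algebra.adjoin_induction with
  | mem x hx =>
    obtain ⟨w, rfl⟩ := hx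
    refine (Set.finite_singleton w).subset fun v hv => ?_
    by_contra h
    exact hv (pd_X_of_ne par h)
  | algebraMap c =>
    refine Set.finite_empty.subset fun v hv => hv ?_
    exact (isSuperderivation_pd v).map_algebraMap c
  | add x y _ _ hx hy =>
    refine (hx.union hy).subset fun v hv => ?_
    by_contra h
    simp only [Set.mem_union, Set.mem_ofPred_eq, not_or, not_not] at h
    exact hv (by rw [map_add, h.1, h.2, add_zero])
  | mul x y _ _ hx hy =>
    refine (hx.union hy).subset fun v hv => ?_
    by_contra h
    simp only [Set.mem_union, Set.mem_ofPred_eq, not_or, not_not] at h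
    exact hv (by rw [pd_mul, h.1, h.2, zero_mul, mul_zero, add_zero])

end SuperPoly

theorem finsum_sum_type {α β M : Type*} [AddCommMonoid M] {f : α ⊕ β → M}
    (hf : (Function.support f).Finite) :
    ∑ᶠ c, f c = ∑ᶠ a, f (Sum.inl a) + ∑ᶠ b, f (Sum.inr b) := by
  rw [← finsum_mem_univ, ← Set.range_inl_union_range_inr,
    finsum_mem_union' Set.isCompl_range_inl_range_inr.disjoint (hf.inter_of_right _)
      (hf.inter_of_right _), finsum_mem_range Sum.inl_injective, finsum_mem_range Sum.inr_injective]

namespace PolarizedAlgebra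

variable {F A : Type*} [Field F] [NonUnitalRing A] [Module F A]
  [IsScalarTower F A A] [SMulCommClass F A A]

/-! ### The bilinear form in terms of the dual bases -/

section Form

variable (S : PolarizedAlgebra F A)

theorem form_eq_zero_of_ne {i j : ZMod 2} {a b : A} (ha : a ∈ S.gr i) (hb : b ∈ S.gr j)
    (hij : i ≠ j) : S.form a b = 0 := by
  rcases parity_cases i with rfl | rfl <;> rcases parity_cases j with rfl | rfl
  · exact absurd rfl hij
  · exact S.form_even ha hb
  · rw [S.form_symm ha hb, S.form_even hb ha, mul_zero]
  · exact absurd rfl hij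

theorem form_comm_of_mem {i : ZMod 2} {a : A} (ha : a ∈ S.gr i) (x : A) :
    S.form a x = sgn F i * S.form x a := by
  have h : ∀ j, ∀ y ∈ S.gr j, S.form a y = sgn F i * S.form y a := by
    intro j y hy
    by_cases hij : i = j
    · subst hij
      rw [S.form_symm ha hy]
      rcases parity_cases i with rfl | rfl <;> simp
    · rw [S.form_eq_zero_of_ne ha hy hij, S.form_eq_zero_of_ne hy ha (Ne.symm hij), mul_zero]
  obtain ⟨x₀, h₀, x₁, h₁, rfl⟩ : ∃ x₀ ∈ S.gr 0, ∃ x₁ ∈ S.gr 1, x₀ + x₁ = x :=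
    Submodule.mem_sup.1 (S.gr_isCompl.sup_eq_top ▸ Submodule.mem_top)
  rw [map_add, map_add, LinearMap.add_apply, h 0 x₀ h₀, h 1 x₁ h₁, mul_add]

end Form

namespace DualBases

variable {S : PolarizedAlgebra F A} {J : Type*} (D : S.DualBases J)

/-- The sign by which the index `c` enters the bilinear form: `⟨ς_c, ς_{-c}⟩`. -/
def wt : D.Idx → F := Sum.elim (fun _ => 1) (fun j => sgn F (D.par j))

theorem wt_mul_self (c : D.Idx) : D.wt c * D.wt c = 1 := by
  rcases c with j | j <;> simp [wt]

theorem wt_mul_wt_swap (c : D.Idx) : D.wt c * D.wt c.swap = sgn F (D.ipar c) := by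
  rcases c with j | j <;> simp [wt, ipar]

@[simp]
theorem ipar_swap (c : D.Idx) : D.ipar c.swap = D.ipar c := by
  rcases c with j | j <;> rfl

theorem elt_mem_gr (c : D.Idx) : D.elt c ∈ S.gr (D.ipar c) := by
  rcases c with j | j
  · exact (D.neg_mem j).2
  · exact (D.pos_mem j).2

theorem wt_mul_coeff (x : A) (c : D.Idx) :
    D.wt c * D.coeff x c = S.form x (D.elt c.swap) := by
  rcases c with j | j
  · exact one_mul _
  · change sgn F (D.par j) * S.form (D.neg j) x = S.form x (D.neg j)
    rw [S.form_comm_of_mem (D.neg_mem j).2, ← mul_assoc, sgn_mul_self, one_mul]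

theorem wt_mul_coeff_swap (x : A) (c : D.Idx) :
    D.wt c * D.coeff x c.swap = S.form (D.elt c) x := by
  rcases c with j | j
  · exact one_mul _
  · exact (S.form_comm_of_mem (D.pos_mem j).2 x).symm

theorem coeff_eq_zero_of_ne {i : ZMod 2} {x : A} (hx : x ∈ S.gr i) {c : D.Idx}
    (hc : D.ipar c ≠ i) : D.coeff x c = 0 := by
  rcases c with j | j
  · exact S.form_eq_zero_of_ne hx (D.pos_mem j).2 (Ne.symm hc)
  · exact S.form_eq_zero_of_ne (D.neg_mem j).2 hx hc

theorem coeff_elt [DecidableEq D.Idx] (c d : D.Idx) :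
    D.coeff (D.elt c) d = if d = c then 1 else 0 := by
  rcases c with j | j <;> rcases d with k | k
  · change S.form (D.neg j) (D.pos k) = _
    by_cases h : k = j
    · subst h; rw [if_pos rfl, D.dual_self]
    · rw [D.dual_ne j k (Ne.symm h), if_neg fun h' => h (Sum.inl_injective h')]
  · exact (S.neg_isotropic (D.neg_mem k).1 (D.neg_mem j).1).trans (if_neg (by simp)).symm
  · exact (S.pos_isotropic (D.pos_mem j).1 (D.pos_mem k).1).trans (if_neg (by simp)).symm
  · change S.form (D.neg k) (D.pos j) = _
    by_cases h : k = j
    · subst h; rw [if_pos rfl, D.dual_self]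
    · rw [D.dual_ne k j h, if_neg fun h' => h (Sum.inr_injective h')]

/-- An element of `A` is a finite combination of the `ς_j`, up to an element of `A^-`. -/
theorem exists_neg_add_sum (x : A) : ∃ n ∈ S.neg,
    x = n + ∑ j ∈ (D.finite_coeff x).toFinset, S.form (D.neg j) x • D.pos j := by
  refine ⟨_, D.mem_neg_of_coeff (x := x - ∑ j ∈ (D.finite_coeff x).toFinset,
    S.form (D.neg j) x • D.pos j) fun k => ?_, (sub_add_cancel _ _).symm⟩
  rw [map_sub, map_sum, sub_eq_zero, Finset.sum_eq_single k]
  · rw [map_smul, D.dual_self, smul_eq_mul, mul_one]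
  · intro j _ hj
    rw [map_smul, D.dual_ne k j hj.symm, smul_zero]
  · intro hk
    rw [Set.Finite.mem_toFinset, Set.mem_ofPred_eq, not_not] at hk
    rw [hk, zero_smul, map_zero]

theorem form_support_finite (x y : A) : (Function.support fun c : D.Idx =>
    D.wt c * (D.coeff x c * D.coeff y c.swap)).Finite := by
  refine (((D.finite_coeff y).image Sum.inl).union ((D.finite_coeff x).image Sum.inr)).subset ?_
  rintro (j | j) h
  · exact Or.inl ⟨j, fun h0 => h (by
      change _ * (_ * S.form (D.neg j) y) = _
      rw [h0, mul_zero, mul_zero]), rfl⟩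
  · exact Or.inr ⟨j, fun h0 => h (by
      change _ * (S.form (D.neg j) x * _) = _
      rw [h0, zero_mul, mul_zero]), rfl⟩

/-- The expansion of the bilinear form in the dual bases. -/
theorem form_eq_finsum (x y : A) :
    S.form x y = ∑ᶠ c : D.Idx, D.wt c * (D.coeff x c * D.coeff y c.swap) := by
  have hx := D.finite_coeff x
  have hy := D.finite_coeff y
  rw [finsum_sum_type (D.form_support_finite x y)]
  obtain ⟨m, hm, h₁⟩ := D.exists_neg_add_sum x
  obtain ⟨n, hn, h₂⟩ := D.exists_neg_add_sum y
  have e₁ : S.form x y = S.form x n +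
      ∑ j ∈ hy.toFinset, S.form (D.neg j) y * S.form x (D.pos j) := by
    conv_lhs => rw [h₂]
    rw [map_add, map_sum]
    simp only [map_smul, smul_eq_mul]
  have e₂ : S.form x n =
      ∑ j ∈ hx.toFinset, S.form (D.neg j) x * S.form (D.pos j) n := by
    conv_lhs => rw [h₁]
    rw [map_add, map_sum, LinearMap.add_apply, S.neg_isotropic hm hn, zero_add,
      LinearMap.sum_apply]
    simp only [map_smul, LinearMap.smul_apply, smul_eq_mul]
  have e₃ : ∀ j, S.form (D.pos j) n = S.form (D.pos j) y := fun j => by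
    conv_rhs => rw [h₂]
    rw [map_add, map_sum, Finset.sum_eq_zero, add_zero]
    intro k _
    rw [map_smul, S.pos_isotropic (D.pos_mem j).1 (D.pos_mem k).1, smul_zero]
  rw [e₁, e₂, add_comm, finsum_eq_sum_of_support_subset (s := hy.toFinset),
    finsum_eq_sum_of_support_subset (s := hx.toFinset)]
  · refine congrArg₂ _ (Finset.sum_congr rfl fun j _ => ?_) (Finset.sum_congr rfl fun j _ => ?_)
    · change _ = 1 * (S.form x (D.pos j) * S.form (D.neg j) y)
      ring
    · change _ = sgn F (D.par j) * (S.form (D.neg j) x * S.form y (D.pos j))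
      rw [e₃, S.form_comm_of_mem (D.pos_mem j).2]
      ring
  · intro j h
    rw [Set.Finite.coe_toFinset]
    exact fun h0 => h (by
      change _ * (S.form (D.neg j) x * _) = _
      rw [h0, zero_mul, mul_zero])
  · intro j h
    rw [Set.Finite.coe_toFinset]
    exact fun h0 => h (by
      change _ * (_ * S.form (D.neg j) y) = _
      rw [h0, mul_zero, mul_zero])

/-! ### The product and the bilinear form of `𝒢̄` -/

section Formal

variable (r : ℕ)

local notation "tw" => SuperPoly.twist (D.vpar r)

theorem pairing_support_finite {u v : D.Formal r} (hu : u ∈ D.Gbar r) (hv : v ∈ D.Gbar r) :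
    (Function.support fun c : D.Idx => D.wt c • (u c * tw (D.ipar c) (v c.swap))).Finite := by
  refine ((Set.Finite.image Sum.inl hv).union (Set.Finite.image Sum.inr hu)).subset ?_
  rintro (j | j) h
  · exact Or.inl ⟨j, fun h0 => h (by
      change _ • (_ * tw _ (v (Sum.inr j))) = _
      rw [h0, map_zero, mul_zero, smul_zero]), rfl⟩
  · exact Or.inr ⟨j, fun h0 => h (by
      change _ • (u (Sum.inr j) * _) = _
      rw [h0, zero_mul, smul_zero]), rfl⟩

/-- The bilinear form of `𝒢̄` as a single sum over all indices, positive and negative. -/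
theorem pairing_eq {u v : D.Formal r} (hu : u ∈ D.Gbar r) (hv : v ∈ D.Gbar r) :
    D.pairing r u v = ∑ᶠ c : D.Idx, D.wt c • (u c * tw (D.ipar c) (v c.swap)) := by
  have h := D.pairing_support_finite r hu hv
  rw [finsum_sum_type h, pairing, ← finsum_add_distrib]
  · refine finsum_congr fun j => ?_
    change _ = (1 : F) • _ + _
    rw [one_smul]
    rfl
  · exact h.preimage Sum.inl_injective.injOn
  · exact h.preimage Sum.inr_injective.injOn

theorem mul_add_left (hS : S.IsSemiFinitelyFiltered) {u u' v : D.Formal r} (hu : u ∈ D.Gbar r)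
    (hu' : u' ∈ D.Gbar r) (hv : v ∈ D.Gbar r) :
    D.mul r (u + u') v = D.mul r u v + D.mul r u' v := by
  funext c
  simp only [mul, Pi.add_apply, add_mul, smul_add]
  exact finsum_add_distrib (D.mul_support_finite hS r hu hv c) (D.mul_support_finite hS r hu' hv c)

theorem mul_add_right (hS : S.IsSemiFinitelyFiltered) {u v v' : D.Formal r} (hu : u ∈ D.Gbar r)
    (hv : v ∈ D.Gbar r) (hv' : v' ∈ D.Gbar r) :
    D.mul r u (v + v') = D.mul r u v + D.mul r u v' := by
  funext c
  simp only [mul, Pi.add_apply, map_add, mul_add, smul_add]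
  exact finsum_add_distrib (D.mul_support_finite hS r hu hv c) (D.mul_support_finite hS r hu hv' c)

theorem mul_smul_left (hS : S.IsSemiFinitelyFiltered) (t : F) {u v : D.Formal r}
    (hu : u ∈ D.Gbar r) (hv : v ∈ D.Gbar r) :
    D.mul r (t • u) v = t • D.mul r u v := by
  funext c
  simp only [mul, Pi.smul_apply]
  rw [smul_finsum' _ (D.mul_support_finite hS r hu hv c)]
  simp only [smul_mul_assoc, smul_comm t]

theorem mul_smul_right (hS : S.IsSemiFinitelyFiltered) (t : F) {u v : D.Formal r}
    (hu : u ∈ D.Gbar r) (hv : v ∈ D.Gbar r) :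
    D.mul r u (t • v) = t • D.mul r u v := by
  funext c
  simp only [mul, Pi.smul_apply]
  rw [smul_finsum' _ (D.mul_support_finite hS r hu hv c)]
  simp only [map_smul, mul_smul_comm, smul_comm t]

theorem pairing_add_left {u u' v : D.Formal r} (hu : u ∈ D.Gbar r)
    (hu' : u' ∈ D.Gbar r) (hv : v ∈ D.Gbar r) :
    D.pairing r (u + u') v = D.pairing r u v + D.pairing r u' v := by
  rw [D.pairing_eq r (add_mem hu hu') hv, D.pairing_eq r hu hv, D.pairing_eq r hu' hv,
    ← finsum_add_distrib (D.pairing_support_finite r hu hv) (D.pairing_support_finite r hu' hv)]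
  simp only [Pi.add_apply, add_mul, smul_add]

theorem pairing_add_right {u v v' : D.Formal r} (hu : u ∈ D.Gbar r)
    (hv : v ∈ D.Gbar r) (hv' : v' ∈ D.Gbar r) :
    D.pairing r u (v + v') = D.pairing r u v + D.pairing r u v' := by
  rw [D.pairing_eq r hu (add_mem hv hv'), D.pairing_eq r hu hv, D.pairing_eq r hu hv',
    ← finsum_add_distrib (D.pairing_support_finite r hu hv) (D.pairing_support_finite r hu hv')]
  simp only [Pi.add_apply, map_add, mul_add, smul_add]

theorem pairing_smul_left (t : F) {u v : D.Formal r} (hu : u ∈ D.Gbar r) (hv : v ∈ D.Gbar r) :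
    D.pairing r (t • u) v = t • D.pairing r u v := by
  rw [D.pairing_eq r (Submodule.smul_mem _ t hu) hv, D.pairing_eq r hu hv,
    smul_finsum' _ (D.pairing_support_finite r hu hv)]
  simp only [Pi.smul_apply, smul_mul_assoc, smul_comm t]

theorem pairing_smul_right (t : F) {u v : D.Formal r} (hu : u ∈ D.Gbar r) (hv : v ∈ D.Gbar r) :
    D.pairing r u (t • v) = t • D.pairing r u v := by
  rw [D.pairing_eq r hu (Submodule.smul_mem _ t hv), D.pairing_eq r hu hv,
    smul_finsum' _ (D.pairing_support_finite r hu hv)]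
  simp only [Pi.smul_apply, map_smul, mul_smul_comm, smul_comm t]

/-- The term of `⟨ς_u ς_v, ς_w⟩ = ⟨ς_u, ς_v ς_w⟩` at the indices `a`, `b`, `c`. -/
def triple (u v w : D.Formal r) (p : (D.Idx × D.Idx) × D.Idx) : D.Poly r :=
  S.form (D.elt p.1.1 * D.elt p.1.2) (D.elt p.2) •
    (u p.1.1 * tw (D.ipar p.1.1) (v p.1.2) * tw (D.ipar p.2) (w p.2))

/-- For a positive index `c` only finitely many `ς_a ς_b` contribute to the coefficient at `-c`, and
there are finitely many such `c` with `w_c ≠ 0`; for negative `c` only finitely many pairs `a`, `b`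
with nonzero coefficients have a product with a positive part. -/
theorem triple_support_finite (hS : S.IsSemiFinitelyFiltered) {u v w : D.Formal r}
    (hu : u ∈ D.Gbar r) (hv : v ∈ D.Gbar r) (hw : w ∈ D.Gbar r) :
    (Function.support (D.triple r u v w)).Finite := by
  have hw' : {j : J | w (Sum.inr j) ≠ 0}.Finite := hw
  refine ((hw'.biUnion fun k _ => (D.mul_support_finite hS r hu hv (Sum.inl k)).prod
      (Set.finite_singleton (Sum.inr k))).union
    ((D.finite_pairs hS r hu hv).biUnion fun p _ => (Set.finite_singleton p).prod
      ((D.finite_coeff (D.elt p.1 * D.elt p.2)).image Sum.inl))).subset ?_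
  rintro ⟨⟨a, b⟩, c⟩ h
  have h1 : S.form (D.elt a * D.elt b) (D.elt c) ≠ 0 := fun h0 => h (by
    simp only [triple, h0, zero_smul])
  have h2 : u a * tw (D.ipar a) (v b) ≠ 0 := fun h0 => h (by
    simp only [triple, h0, zero_mul, smul_zero])
  have h3 : w c ≠ 0 := fun h0 => h (by
    simp only [triple, h0, map_zero, mul_zero, smul_zero])
  rcases c with k | k
  · have h4 : S.form (D.neg k) (D.elt a * D.elt b) ≠ 0 := fun h0 => h1
      (form_comm_eq_zero S (S.gr_mul (D.elt_mem_gr a) (D.elt_mem_gr b)) (D.neg_mem k).2 h0)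
    refine Or.inr (Set.mem_biUnion (x := (a, b)) ⟨?_, ?_, k, h4⟩ ⟨rfl, k, h4, rfl⟩)
    · exact fun h0 => h2 (by
        change u a = 0 at h0
        rw [h0, zero_mul])
    · exact fun h0 => h2 (by
        change v b = 0 at h0
        rw [h0, map_zero, mul_zero])
  · exact Or.inl (Set.mem_biUnion (x := k) h3 ⟨smul_ne_zero h1 h2, rfl⟩)

theorem pairing_mul_left (hS : S.IsSemiFinitelyFiltered) {u v w : D.Formal r}
    (hu : u ∈ D.Gbar r) (hv : v ∈ D.Gbar r) (hw : w ∈ D.Gbar r) :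
    D.pairing r (D.mul r u v) w = ∑ᶠ p, D.triple r u v w p := by
  have hfin := D.triple_support_finite r hS hu hv hw
  rw [D.pairing_eq r (D.mul_mem_Gbar hS r hu hv) hw,
    ← finsum_comp_equiv (Equiv.prodComm D.Idx (D.Idx × D.Idx)), finsum_curry]
  swap
  · exact hfin.preimage (Equiv.injective _).injOn
  rw [← finsum_comp_equiv (Equiv.sumComm J J)]
  refine finsum_congr fun c => ?_
  let φ : D.Poly r →ₗ[F] D.Poly r :=
    D.wt c.swap • (LinearMap.mulRight F (tw (D.ipar c.swap) (w c.swap.swap)))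
  change φ (∑ᶠ p : D.Idx × D.Idx, _) = _
  rw [map_finsum φ (D.mul_support_finite hS r hu hv _)]
  refine finsum_congr fun p => ?_
  change D.wt c.swap • ((D.coeff (D.elt p.1 * D.elt p.2) c.swap •
    (u p.1 * tw (D.ipar p.1) (v p.2))) * tw (D.ipar c.swap) (w c.swap.swap)) =
      S.form _ (D.elt c) • _
  rw [Sum.swap_swap, smul_mul_assoc, smul_smul, wt_mul_coeff, Sum.swap_swap, ipar_swap]
  rfl

theorem pairing_mul_right (hS : S.IsSemiFinitelyFiltered) {u v w : D.Formal r}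
    (hu : u ∈ D.Gbar r) (hv : v ∈ D.Gbar r) (hw : w ∈ D.Gbar r) :
    D.pairing r u (D.mul r v w) = ∑ᶠ p, D.triple r u v w p := by
  have hfin := D.triple_support_finite r hS hu hv hw
  rw [D.pairing_eq r hu (D.mul_mem_Gbar hS r hv hw),
    ← finsum_comp_equiv (Equiv.prodAssoc D.Idx D.Idx D.Idx).symm, finsum_curry]
  swap
  · exact hfin.preimage (Equiv.injective _).injOn
  refine finsum_congr fun a => ?_
  let φ : D.Poly r →ₗ[F] D.Poly r :=
    D.wt a • (LinearMap.mulLeft F (u a) ∘ₗ tw (D.ipar a))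
  change φ (∑ᶠ p : D.Idx × D.Idx, _) = _
  rw [map_finsum φ (D.mul_support_finite hS r hv hw _)]
  refine finsum_congr fun p => ?_
  obtain ⟨b, c⟩ := p
  change D.wt a • (u a * tw _ (D.coeff _ a.swap • _)) =
    S.form (D.elt a * D.elt b) (D.elt c) • (u a * tw (D.ipar a) (v b) * tw (D.ipar c) (w c))
  rw [map_smul, mul_smul_comm, smul_smul, wt_mul_coeff_swap, S.form_assoc]
  by_cases h : D.ipar a + D.ipar b = D.ipar c
  · rw [SuperPoly.twist_mul, SuperPoly.twist_twist, h, mul_assoc]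
  · rw [← S.form_assoc, S.form_eq_zero_of_ne (S.gr_mul (D.elt_mem_gr a) (D.elt_mem_gr b))
      (D.elt_mem_gr c) h, zero_smul, zero_smul]

/-- The bilinear form of `𝒢̄` is associative. -/
theorem pairing_assoc (hS : S.IsSemiFinitelyFiltered) {u v w : D.Formal r}
    (hu : u ∈ D.Gbar r) (hv : v ∈ D.Gbar r) (hw : w ∈ D.Gbar r) :
    D.pairing r (D.mul r u v) w = D.pairing r u (D.mul r v w) := by
  rw [D.pairing_mul_left r hS hu hv hw, D.pairing_mul_right r hS hu hv hw]

theorem emb_mem_Gbar (a : A) : D.emb r a ∈ D.Gbar r := by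
  refine (D.finite_coeff a).subset fun j hj h => hj ?_
  change algebraMap F _ (S.form (D.neg j) a) = 0
  rw [h, map_zero]

theorem emb_elt [DecidableEq D.Idx] (c : D.Idx) : D.emb r (D.elt c) = Pi.single c 1 := by
  funext d
  rw [emb, coeff_elt, Pi.single_apply]
  split_ifs
  · exact map_one (algebraMap F (D.Poly r))
  · exact map_zero (algebraMap F (D.Poly r))

theorem twist_emb (i : ZMod 2) (a : A) (c : D.Idx) : tw i (D.emb r a c) = D.emb r a c := by
  refine (SuperPoly.twist_of_mem i (SuperPoly.algebraMap_mem_part _)).trans ?_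
  rw [mul_zero, sgn_zero, one_smul]
  rfl

theorem pairing_emb_elt {u : D.Formal r} (hu : u ∈ D.Gbar r) (c : D.Idx) :
    D.pairing r u (D.emb r (D.elt c)) = D.wt c.swap • u c.swap := by
  classical
  rw [D.pairing_eq r hu (D.emb_mem_Gbar r _), finsum_eq_single _ c.swap]
  · rw [twist_emb, emb_elt, Sum.swap_swap, Pi.single_eq_same, mul_one]
  · intro d hd
    have : d.swap ≠ c := fun h => hd (by rw [← h, Sum.swap_swap])
    rw [twist_emb, emb_elt, Pi.single_eq_of_ne this, mul_zero, smul_zero]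

/-- The bilinear form of `𝒢̄` is nondegenerate. -/
theorem eq_of_pairing_eq {u v : D.Formal r} (hu : u ∈ D.Gbar r) (hv : v ∈ D.Gbar r)
    (h : ∀ c, D.pairing r u (D.emb r (D.elt c)) = D.pairing r v (D.emb r (D.elt c))) : u = v := by
  funext c
  have h1 := congrArg (D.wt c • ·) (h c.swap)
  simpa only [D.pairing_emb_elt r hu, D.pairing_emb_elt r hv, Sum.swap_swap, smul_smul,
    wt_mul_self, one_smul] using h1

theorem pairing_emb_emb (a b : A) :
    D.pairing r (D.emb r a) (D.emb r b) = algebraMap F _ (S.form a b) := by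
  have key : ∀ c : D.Idx, D.wt c • (D.emb r a c * tw (D.ipar c) (D.emb r b c.swap)) =
      algebraMap F (D.Poly r) (D.wt c * (D.coeff a c * D.coeff b c.swap)) := fun c => by
    rw [twist_emb, map_mul, map_mul]
    exact Algebra.smul_def (D.wt c) (D.emb r a c * D.emb r b c.swap)
  rw [D.pairing_eq r (D.emb_mem_Gbar r _) (D.emb_mem_Gbar r _), D.form_eq_finsum,
    map_finsum (algebraMap F (D.Poly r))]
  · exact finsum_congr key
  · exact D.form_support_finite a b

theorem emb_elt_mul_emb_elt (a b : D.Idx) :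
    D.mul r (D.emb r (D.elt a)) (D.emb r (D.elt b)) = D.emb r (D.elt a * D.elt b) := by
  classical
  funext c
  rw [mul, finsum_eq_single _ (a, b)]
  · rw [twist_emb, emb_elt, emb_elt, Pi.single_eq_same, Pi.single_eq_same, mul_one, emb,
      Algebra.algebraMap_eq_smul_one]
  · rintro ⟨a', b'⟩ h
    rw [twist_emb, emb_elt, emb_elt]
    by_cases ha : a' = a
    · have hb : b' ≠ b := fun hb => h (by rw [ha, hb])
      rw [Pi.single_eq_of_ne hb, mul_zero, smul_zero]
    · rw [Pi.single_eq_of_ne ha, zero_mul, smul_zero]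

theorem emb_mul_emb_elt (hS : S.IsSemiFinitelyFiltered) (a : A) (b : D.Idx) :
    D.mul r (D.emb r a) (D.emb r (D.elt b)) = D.emb r (a * D.elt b) := by
  refine D.eq_of_pairing_eq r (D.mul_mem_Gbar hS r (D.emb_mem_Gbar r _) (D.emb_mem_Gbar r _))
    (D.emb_mem_Gbar r _) fun c => ?_
  rw [D.pairing_assoc r hS (D.emb_mem_Gbar r _) (D.emb_mem_Gbar r _) (D.emb_mem_Gbar r _),
    emb_elt_mul_emb_elt, pairing_emb_emb, pairing_emb_emb, S.form_assoc]

/-- `A` is a subalgebra of `𝒢̄`. -/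
theorem emb_mul_emb (hS : S.IsSemiFinitelyFiltered) (a b : A) :
    D.mul r (D.emb r a) (D.emb r b) = D.emb r (a * b) := by
  refine D.eq_of_pairing_eq r (D.mul_mem_Gbar hS r (D.emb_mem_Gbar r _) (D.emb_mem_Gbar r _))
    (D.emb_mem_Gbar r _) fun c => ?_
  rw [D.pairing_assoc r hS (D.emb_mem_Gbar r _) (D.emb_mem_Gbar r _) (D.emb_mem_Gbar r _),
    D.emb_mul_emb_elt r hS, pairing_emb_emb, pairing_emb_emb, S.form_assoc]

/-- By nondegeneracy and associativity of the bilinear form, associativity of the product at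
`u, v, w` follows from associativity at `v, w, ς_c`. -/
theorem mul_assoc_of_mul_assoc_elt (hS : S.IsSemiFinitelyFiltered) {u v w : D.Formal r}
    (hu : u ∈ D.Gbar r) (hv : v ∈ D.Gbar r) (hw : w ∈ D.Gbar r)
    (h : ∀ c, D.mul r (D.mul r v w) (D.emb r (D.elt c)) =
      D.mul r v (D.mul r w (D.emb r (D.elt c)))) :
    D.mul r (D.mul r u v) w = D.mul r u (D.mul r v w) := by
  have hm := fun {x y} hx hy => D.mul_mem_Gbar hS r (u := x) (v := y) hx hy
  refine D.eq_of_pairing_eq r (hm (hm hu hv) hw) (hm hu (hm hv hw)) fun c => ?_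
  have hc := D.emb_mem_Gbar r (D.elt c)
  rw [D.pairing_assoc r hS (hm hu hv) hw hc, D.pairing_assoc r hS hu hv (hm hw hc),
    D.pairing_assoc r hS hu (hm hv hw) hc, h]

/-- The product of `𝒢̄` is associative: three applications of `mul_assoc_of_mul_assoc_elt` reduce
this to three elements of `A`. -/
theorem mul_assoc_Gbar (hS : S.IsSemiFinitelyFiltered) {u v w : D.Formal r}
    (hu : u ∈ D.Gbar r) (hv : v ∈ D.Gbar r) (hw : w ∈ D.Gbar r) :
    D.mul r (D.mul r u v) w = D.mul r u (D.mul r v w) := by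
  have he := fun c => D.emb_mem_Gbar r (D.elt c)
  refine D.mul_assoc_of_mul_assoc_elt r hS hu hv hw fun a => ?_
  refine D.mul_assoc_of_mul_assoc_elt r hS hv hw (he a) fun b => ?_
  refine D.mul_assoc_of_mul_assoc_elt r hS hw (he a) (he b) fun c => ?_
  rw [D.emb_mul_emb r hS, D.emb_mul_emb r hS, D.emb_mul_emb r hS, D.emb_mul_emb r hS, mul_assoc]

end Formal

end DualBases

end PolarizedAlgebra

/-! ### The Jacobi identity for a split graded ring with an invariant form -/

/-- A `ℤ/2`-graded associative algebra `G` which is the sum `G_+ + G_-` of two graded subalgebras,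
the images of the maps `plus` and `minus`, isotropic for an associative supersymmetric bilinear
form with values in a vector space `P`. It is only required that `plus` and `minus` add up to the
identity: idempotency is not needed for the Jacobi identity. -/
structure Splitting (F G P : Type*) [Field F] [NonUnitalRing G] [Module F G] [AddCommGroup P]
    [Module F P] where
  gr : ZMod 2 → Submodule F G
  form : G →ₗ[F] G →ₗ[F] P
  plus : G →ₗ[F] G
  minus : G →ₗ[F] G
  mul_mem : ∀ {i j : ZMod 2} {u v : G}, u ∈ gr i → v ∈ gr j → u * v ∈ gr (i + j)
  plus_mem : ∀ {i : ZMod 2} {u : G}, u ∈ gr i → plus u ∈ gr i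
  minus_mem : ∀ {i : ZMod 2} {u : G}, u ∈ gr i → minus u ∈ gr i
  form_assoc : ∀ u v w : G, form (u * v) w = form u (v * w)
  form_symm : ∀ {i j : ZMod 2} {u v : G}, u ∈ gr i → v ∈ gr j →
    form u v = sgn F (i * j) • form v u
  plus_add_minus : ∀ u : G, plus u + minus u = u
  minus_plus_mul_plus : ∀ u v : G, minus (plus u * plus v) = 0
  plus_minus_mul_minus : ∀ u v : G, plus (minus u * minus v) = 0
  form_plus_plus : ∀ u v : G, form (plus u) (plus v) = 0
  form_minus_minus : ∀ u v : G, form (minus u) (minus v) = 0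

namespace Splitting

variable {F G P : Type*} [Field F] [NonUnitalRing G] [Module F G]
  [AddCommGroup P] [Module F P] (T : Splitting F G P)

theorem plus_eq (u : G) : T.plus u = u - T.minus u :=
  eq_sub_of_add_eq (T.plus_add_minus u)

theorem form_minus_left (u v : G) : T.form (T.minus u) v = T.form u (T.plus v) := by
  conv_lhs => rw [← T.plus_add_minus v]
  conv_rhs => rw [← T.plus_add_minus u]
  rw [map_add, map_add, LinearMap.add_apply, T.form_minus_minus, T.form_plus_plus, add_zero,
    zero_add]

theorem form_minus_right (u v : G) : T.form u (T.minus v) = T.form (T.plus u) v := by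
  conv_lhs => rw [← T.plus_add_minus u]
  conv_rhs => rw [← T.plus_add_minus v]
  rw [map_add, map_add, LinearMap.add_apply, T.form_minus_minus, T.form_plus_plus, add_zero,
    zero_add]

/-- A Rota–Baxter type identity for `minus`, which holds since the images of `plus` and `minus` are
subalgebras. It is what makes the Hamiltonian vector fields close under the supercommutator. -/
theorem minus_mul (u v : G) :
    T.minus (u * v) =
      T.minus (T.minus u * v) + T.minus (u * T.minus v) - T.minus u * T.minus v := by
  have h₁ := T.minus_plus_mul_plus u v
  have h₂ : T.minus (T.minus u * T.minus v) = T.minus u * T.minus v := by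
    have := T.plus_add_minus (T.minus u * T.minus v)
    rwa [T.plus_minus_mul_minus, zero_add] at this
  rw [T.plus_eq, T.plus_eq, sub_mul, mul_sub, mul_sub, map_sub, map_sub, map_sub, h₂] at h₁
  rw [← sub_eq_zero, ← h₁]
  abel

/-- The quadratic Hamiltonian vector field `(L X)_- L - L (X L)_-`. -/
def field (L X : G) : G := T.minus (L * X) * L - L * T.minus (X * L)

/-- The derivative of `field L X` along a superderivation that maps `L` to `E` and
`X` to `0`; the sign `s` arises from moving the derivation past `X`. -/
def fieldDeriv (L X E : G) (s : F) : G :=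
  T.minus (E * X) * L + s • (T.minus (L * X) * E) - E * T.minus (X * L) -
    s • (L * T.minus (X * E))

/-- The gradient in `L` of `⟨field L X, Y⟩`, where `e` is the sign of exchanging `X` and `Y`. -/
def grad (L X Y : G) (e : F) : G :=
  X * T.plus (L * Y) + e • (Y * T.minus (L * X)) - T.minus (X * L) * Y -
    e • (T.plus (Y * L) * X)

variable {T}

theorem field_mem {L X : G} {p : ZMod 2} (hL : L ∈ T.gr 0) (hX : X ∈ T.gr p) :
    T.field L X ∈ T.gr p := by
  have h₁ := T.mul_mem (T.minus_mem (T.mul_mem hL hX)) hL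
  have h₂ := T.mul_mem hL (T.minus_mem (T.mul_mem hX hL))
  rw [zero_add, add_zero] at h₁ h₂
  exact sub_mem h₁ h₂

theorem grad_mem {L X Y : G} {p q : ZMod 2} (e : F) (hL : L ∈ T.gr 0) (hX : X ∈ T.gr p)
    (hY : Y ∈ T.gr q) : T.grad L X Y e ∈ T.gr (p + q) := by
  have h₁ := T.mul_mem hX (T.plus_mem (T.mul_mem hL hY))
  have h₂ := T.mul_mem hY (T.minus_mem (T.mul_mem hL hX))
  have h₃ := T.mul_mem (T.minus_mem (T.mul_mem hX hL)) hY
  have h₄ := T.mul_mem (T.plus_mem (T.mul_mem hY hL)) hX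
  rw [zero_add] at h₁ h₂
  rw [add_zero] at h₃ h₄
  rw [add_comm q p] at h₂ h₄
  exact sub_mem (sub_mem (add_mem h₁ (Submodule.smul_mem _ _ h₂)) h₃) (Submodule.smul_mem _ _ h₄)

theorem form_comm_even {u v : G} {i : ZMod 2} (hu : u ∈ T.gr 0) (hv : v ∈ T.gr i) :
    T.form u v = T.form v u := by
  rw [T.form_symm hu hv, zero_mul, sgn_zero, one_smul]

theorem form_comm_even_of_exists {u v : G} (hu : u ∈ T.gr 0)
    (hv : ∃ v₀ ∈ T.gr 0, ∃ v₁ ∈ T.gr 1, v = v₀ + v₁) : T.form u v = T.form v u := by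
  obtain ⟨v₀, h₀, v₁, h₁, rfl⟩ := hv
  rw [map_add, map_add, LinearMap.add_apply, form_comm_even hu h₀, form_comm_even hu h₁]

theorem form_field {L X Y : G} {p q : ZMod 2} (hL : L ∈ T.gr 0) (hX : X ∈ T.gr p)
    (hY : Y ∈ T.gr q) : T.form (T.field L X) Y =
      T.form (T.minus (L * X)) (T.plus (L * Y)) -
        sgn F (p * q) • T.form (T.plus (Y * L)) (T.minus (X * L)) := by
  have h₁ : T.form (T.minus (L * X)) (L * Y) = T.form (T.minus (L * X)) (T.plus (L * Y)) := by
    conv_lhs => rw [← T.plus_add_minus (L * Y)]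
    rw [map_add, T.form_minus_minus, add_zero]
  have h₂ : T.form (Y * L) (T.minus (X * L)) = T.form (T.plus (Y * L)) (T.minus (X * L)) := by
    conv_lhs => rw [← T.plus_add_minus (Y * L)]
    rw [map_add, LinearMap.add_apply, T.form_minus_minus, add_zero]
  have h₃ := T.mul_mem hL (T.minus_mem (T.mul_mem hX hL))
  rw [zero_add, add_zero] at h₃
  rw [field, map_sub, LinearMap.sub_apply, T.form_assoc, h₁, T.form_symm h₃ hY, ← T.form_assoc, h₂]

/-- The quadratic bracket is skew-supersymmetric, because `⟨L X, L Y⟩ = ± ⟨Y L, X L⟩`. -/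
theorem form_field_skew {L X Y : G} {p q : ZMod 2} (hL : L ∈ T.gr 0) (hX : X ∈ T.gr p)
    (hY : Y ∈ T.gr q) :
    T.form (T.field L X) Y = -(sgn F (p * q) • T.form (T.field L Y) X) := by
  have hLX := T.mul_mem hL hX
  have hLY := T.mul_mem hL hY
  have hXL := T.mul_mem hX hL
  have hYL := T.mul_mem hY hL
  rw [zero_add] at hLX hLY
  rw [add_zero] at hXL hYL
  have key : T.form (L * X) (L * Y) = sgn F (p * q) • T.form (Y * L) (X * L) := by
    rw [← T.form_symm hXL hYL, T.form_assoc, form_comm_even hL (T.mul_mem hX hLY), T.form_assoc,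
      T.form_assoc, mul_assoc]
  have e₁ : T.form (L * X) (L * Y) = T.form (T.minus (L * X)) (T.plus (L * Y)) +
      T.form (T.plus (L * X)) (T.minus (L * Y)) := by
    conv_lhs => rw [← T.plus_add_minus (L * X), ← T.plus_add_minus (L * Y)]
    simp only [map_add, LinearMap.add_apply, T.form_plus_plus, T.form_minus_minus]
    abel
  have e₂ : T.form (Y * L) (X * L) = T.form (T.minus (Y * L)) (T.plus (X * L)) +
      T.form (T.plus (Y * L)) (T.minus (X * L)) := by
    conv_lhs => rw [← T.plus_add_minus (Y * L), ← T.plus_add_minus (X * L)]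
    simp only [map_add, LinearMap.add_apply, T.form_plus_plus, T.form_minus_minus]
    abel
  rw [e₁, e₂, T.form_symm (T.plus_mem hLX) (T.minus_mem hLY),
    T.form_symm (T.minus_mem hYL) (T.plus_mem hXL)] at key
  rw [form_field hL hX hY, form_field hL hY hX]
  linear_combination (norm := module) key

/-- The differential of the quadratic bracket: `grad` is the gradient of `⟨field L X, Y⟩`. -/
theorem form_fieldDeriv {L X Y E : G} {p q t : ZMod 2} (hL : L ∈ T.gr 0) (hX : X ∈ T.gr p)
    (hY : Y ∈ T.gr q) (hE : E ∈ T.gr t) :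
    T.form (T.fieldDeriv L X E (sgn F (t * p))) Y = T.form E (T.grad L X Y (sgn F (p * q))) := by
  have hLX := T.mul_mem hL hX
  have hYL := T.mul_mem hY hL
  rw [zero_add] at hLX
  rw [add_zero] at hYL
  have h₁ : T.form (T.minus (E * X) * L) Y = T.form E (X * T.plus (L * Y)) := by
    rw [T.form_assoc, T.form_minus_left, T.form_assoc]
  have h₂ : T.form (T.minus (L * X) * E) Y =
      sgn F (p * (t + q)) • T.form E (Y * T.minus (L * X)) := by
    rw [T.form_assoc, T.form_symm (T.minus_mem hLX) (T.mul_mem hE hY), T.form_assoc]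
  have h₃ : T.form (L * T.minus (X * E)) Y =
      (sgn F ((p + t) * q) * sgn F ((q + p) * t)) • T.form E (T.plus (Y * L) * X) := by
    have h := T.mul_mem hL (T.minus_mem (T.mul_mem hX hE))
    rw [zero_add] at h
    rw [T.form_symm h hY, ← T.form_assoc, T.form_minus_right, ← T.form_assoc,
      T.form_symm (T.mul_mem (T.plus_mem hYL) hX) hE, smul_smul]
  have s₁ : sgn F (t * p) * sgn F (p * (t + q)) = sgn F (p * q) := by
    rw [mul_add, sgn_add, ← mul_assoc, mul_comm p t, sgn_mul_self, one_mul]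
  have s₂ : sgn F (t * p) * (sgn F ((p + t) * q) * sgn F ((q + p) * t)) = sgn F (p * q) := by
    rw [← sgn_add, ← sgn_add]
    congr 1
    linear_combination (t * p + t * q) * (CharTwo.two_eq_zero (R := ZMod 2))
  simp only [fieldDeriv, grad, map_add, map_sub, map_smul, LinearMap.add_apply,
    LinearMap.sub_apply, LinearMap.smul_apply, h₁, h₂, h₃, smul_smul, s₁, s₂, T.form_assoc]

/-- The Hamiltonian vector fields are closed under the supercommutator: the commutator of the
fields of `X` and `Y` is the field of the gradient of the bracket of `X` and `Y`. -/
theorem fieldDeriv_sub_fieldDeriv [IsScalarTower F G G] [SMulCommClass F G G] (L X Y : G)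
    (i : ZMod 2) :
    T.fieldDeriv L Y (T.field L X) (sgn F i) -
      sgn F i • T.fieldDeriv L X (T.field L Y) (sgn F i) =
      T.field L (T.grad L X Y (sgn F i)) := by
  have h₁ := T.minus_mul (L * X) (L * Y)
  have h₂ := T.minus_mul (L * Y) (L * X)
  have h₃ := T.minus_mul (X * L) (Y * L)
  have h₄ := T.minus_mul (Y * L) (X * L)
  simp only [mul_assoc] at h₁ h₂ h₃ h₄
  rcases parity_cases i with rfl | rfl <;>
  simp only [fieldDeriv, field, grad, sgn_zero, sgn_one, one_smul, neg_smul, T.plus_eq, mul_assoc,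
    mul_add, add_mul, mul_sub, sub_mul, mul_neg, neg_mul, map_add, map_sub, map_neg, h₁, h₂, h₃,
    h₄] <;>
  abel

/-- The linearization in `L` of the quadratic vector field in the direction `K`. -/
def linearField (T : Splitting F G P) (L K X : G) : G :=
  T.minus (K * X) * L + T.minus (L * X) * K - K * T.minus (X * L) - L * T.minus (X * K)

theorem linearField_add (T : Splitting F G P) (L K X Y : G) :
    T.linearField L K (X + Y) = T.linearField L K X + T.linearField L K Y := by
  simp only [linearField, mul_add, add_mul, map_add]
  abel

theorem field_add_smul [IsScalarTower F G G] [SMulCommClass F G G] {K : G}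
    (hK : ∀ u, K * u = u * K) (L X : G) (c : F) :
    T.field (L + c • K) X = T.field L X + c • T.linearField L K X := by
  have h : T.minus (K * X) * K = K * T.minus (X * K) := by rw [hK X, hK]
  simp only [field, linearField, add_mul, mul_add, smul_mul_assoc, mul_smul_comm, map_add,
    map_smul, h]
  module

/-- The linear bracket in terms of supercommutators, for `X`, `Y` of parities `p`, `q`. -/
theorem form_linearField {L K X Y : G} {p q : ZMod 2} (hL : L ∈ T.gr 0) (hK : K ∈ T.gr 0)
    (hKc : ∀ u, K * u = u * K) (hX : X ∈ T.gr p) (hY : Y ∈ T.gr q) :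
    T.form (T.linearField L K X) Y =
      T.form L ((X * T.plus (K * Y) - sgn F (p * q) • (T.plus (K * Y) * X)) -
        (T.minus (K * X) * Y - sgn F (p * q) • (Y * T.minus (K * X)))) := by
  have hLY := T.mul_mem hL hY
  have hKX := T.mul_mem hK hX
  have hKY := T.mul_mem hK hY
  have hXL := T.mul_mem hX hL
  rw [zero_add] at hLY hKX hKY
  rw [add_zero] at hXL
  have h₁ : T.form (T.minus (K * X) * L) Y = sgn F (p * q) • T.form L (Y * T.minus (K * X)) := by
    rw [T.form_assoc, T.form_symm (T.minus_mem hKX) hLY, T.form_assoc]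
  have h₂ : T.form (T.minus (L * X) * K) Y = T.form L (X * T.plus (K * Y)) := by
    rw [T.form_assoc, T.form_minus_left, T.form_assoc]
  have h₃ : T.form (K * T.minus (X * L)) Y = sgn F (p * q) • T.form L (T.plus (K * Y) * X) := by
    rw [hKc (T.minus _), T.form_assoc, T.form_minus_left, T.form_symm hXL (T.plus_mem hKY),
      form_comm_even hL (T.mul_mem (T.plus_mem hKY) hX), T.form_assoc]
  have h₄ : T.form (L * T.minus (X * K)) Y = T.form L (T.minus (K * X) * Y) := by
    rw [T.form_assoc, hKc X]
  simp only [linearField, map_sub, map_add, map_smul, LinearMap.sub_apply, LinearMap.add_apply,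
    h₁, h₂, h₃, h₄]
  abel

end Splitting

namespace PolarizedAlgebra

namespace DualBases

variable {F A : Type*} [Field F] [NonUnitalRing A] [Module F A]
  [IsScalarTower F A A] [SMulCommClass F A A]
  {S : PolarizedAlgebra F A} {J : Type*} (D : S.DualBases J) (r : ℕ)

local notation "tw" => SuperPoly.twist (D.vpar r)

/-! ### The grading of `𝒢̄`, and its splitting into `ς_j` and `ς_{-j}` -/

/-- The formal sums of parity `p`. -/
def homog (p : ZMod 2) : Submodule F (D.Formal r) where
  carrier := {u | ∀ c, u c ∈ SuperPoly.part (D.vpar r) (D.ipar c + p)}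
  zero_mem' := fun _ => zero_mem _
  add_mem' := fun hu hv c => add_mem (hu c) (hv c)
  smul_mem' := fun t _ hu c => Submodule.smul_mem _ t (hu c)

theorem comp_of_mem_homog {p : ZMod 2} {u : D.Formal r} (hu : u ∈ D.homog r p) (q : ZMod 2) :
    D.comp r q u = if p = q then u else 0 := by
  funext c
  rw [comp, SuperPoly.comp_of_mem (hu c)]
  simp only [add_right_inj]
  split_ifs <;> rfl

theorem comp_mem_homog (p : ZMod 2) (u : D.Formal r) : D.comp r p u ∈ D.homog r p :=
  fun _ => SuperPoly.comp_mem _ _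

theorem comp_mem_Gbar (p : ZMod 2) {u : D.Formal r} (hu : u ∈ D.Gbar r) :
    D.comp r p u ∈ D.Gbar r := by
  refine Set.Finite.subset hu fun j hj h => hj ?_
  change SuperPoly.comp _ _ (u (Sum.inr j)) = 0
  rw [h, map_zero]

theorem homog_comp_add_comp (u : D.Formal r) : D.comp r 0 u + D.comp r 1 u = u := by
  funext c
  change SuperPoly.comp _ (D.ipar c + 0) (u c) + SuperPoly.comp _ (D.ipar c + 1) (u c) = u c
  rcases parity_cases (D.ipar c) with h | h <;> rw [h]
  · exact SuperPoly.comp_add_comp (u c)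
  · rw [add_comm, CharTwo.add_self_eq_zero]
    exact SuperPoly.comp_add_comp (u c)

theorem mul_mem_homog {p q : ZMod 2} {u v : D.Formal r}
    (hu : u ∈ D.homog r p) (hv : v ∈ D.homog r q) : D.mul r u v ∈ D.homog r (p + q) := by
  intro c
  refine finsum_induction (· ∈ SuperPoly.part (D.vpar r) (D.ipar c + (p + q)))
    (zero_mem _) (fun _ _ => add_mem) fun ⟨a, b⟩ => ?_
  by_cases h : D.ipar c = D.ipar a + D.ipar b
  · refine Submodule.smul_mem _ _ ?_
    have := SuperPoly.mul_mem_part (hu a) (SuperPoly.twist_mem (D.ipar a) (hv b))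
    rwa [add_add_add_comm, ← h] at this
  · rw [D.coeff_eq_zero_of_ne (S.gr_mul (D.elt_mem_gr a) (D.elt_mem_gr b)) h, zero_smul]
    exact zero_mem _

theorem pairing_mem_part {p q : ZMod 2} {u v : D.Formal r} (hu : u ∈ D.Gbar r)
    (hv : v ∈ D.Gbar r) (hu' : u ∈ D.homog r p) (hv' : v ∈ D.homog r q) :
    D.pairing r u v ∈ SuperPoly.part (D.vpar r) (p + q) := by
  rw [D.pairing_eq r hu hv]
  refine finsum_induction (· ∈ SuperPoly.part (D.vpar r) (p + q))
    (zero_mem _) (fun _ _ => add_mem) fun c => ?_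
  refine Submodule.smul_mem _ _ ?_
  have := SuperPoly.mul_mem_part (hu' c) (SuperPoly.twist_mem (D.ipar c) (hv' c.swap))
  rwa [ipar_swap, add_add_add_comm, CharTwo.add_self_eq_zero, zero_add] at this

/-- The bilinear form of `𝒢̄` is supersymmetric. -/
theorem pairing_symm {p q : ZMod 2} {u v : D.Formal r} (hu : u ∈ D.Gbar r)
    (hv : v ∈ D.Gbar r) (hu' : u ∈ D.homog r p) (hv' : v ∈ D.homog r q) :
    D.pairing r u v = sgn F (p * q) • D.pairing r v u := by
  rw [D.pairing_eq r hu hv, D.pairing_eq r hv hu,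
    smul_finsum' _ (D.pairing_support_finite r hv hu), ← finsum_comp_equiv (Equiv.sumComm J J)]
  refine finsum_congr fun c => ?_
  change D.wt c.swap • (u c.swap * tw (D.ipar c.swap) (v c.swap.swap)) =
    sgn F (p * q) • D.wt c • (v c * tw (D.ipar c) (u c.swap))
  have h := hu' c.swap
  rw [ipar_swap] at h
  rw [Sum.swap_swap, ipar_swap, SuperPoly.twist_of_mem _ (hv' c), SuperPoly.twist_of_mem _ h,
    mul_smul_comm, mul_smul_comm, SuperPoly.mul_comm_of_mem h (hv' c)]
  simp only [smul_smul]
  congr 1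
  have hw : D.wt c.swap = sgn F (D.ipar c) * D.wt c := by
    rw [← wt_mul_wt_swap, mul_right_comm, wt_mul_self, one_mul]
  have hs : sgn F (D.ipar c) * sgn F (D.ipar c * (D.ipar c + q)) *
      sgn F ((D.ipar c + p) * (D.ipar c + q)) =
        sgn F (p * q) * sgn F (D.ipar c * (D.ipar c + p)) := by
    simp only [← sgn_add]
    congr 1
    rcases parity_cases (D.ipar c) with h | h <;> rw [h]
    · ring
    · linear_combination (1 + q) * (CharTwo.two_eq_zero (R := ZMod 2))
  rw [hw]
  linear_combination D.wt c * hs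

theorem plus_add (u v : D.Formal r) : D.plus r (u + v) = D.plus r u + D.plus r v := by
  funext c
  rcases c with j | j
  · exact (add_zero (0 : D.Poly r)).symm
  · rfl

theorem plus_smul (t : F) (u : D.Formal r) : D.plus r (t • u) = t • D.plus r u := by
  funext c
  rcases c with j | j
  · exact (smul_zero (A := D.Poly r) t).symm
  · rfl

theorem minus_add (u v : D.Formal r) : D.minus r (u + v) = D.minus r u + D.minus r v := by
  funext c
  rcases c with j | j
  · rfl
  · exact (add_zero (0 : D.Poly r)).symm

theorem minus_smul (t : F) (u : D.Formal r) : D.minus r (t • u) = t • D.minus r u := by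
  funext c
  rcases c with j | j
  · rfl
  · exact (smul_zero (A := D.Poly r) t).symm

theorem plus_mem_Gbar {u : D.Formal r} (hu : u ∈ D.Gbar r) : D.plus r u ∈ D.Gbar r := hu

theorem minus_mem_Gbar (u : D.Formal r) : D.minus r u ∈ D.Gbar r := by
  refine Set.finite_empty.subset fun j hj => hj rfl

theorem plus_mem_homog {p : ZMod 2} {u : D.Formal r} (hu : u ∈ D.homog r p) :
    D.plus r u ∈ D.homog r p := by
  rintro (j | j)
  · exact zero_mem _
  · exact hu _

theorem minus_mem_homog {p : ZMod 2} {u : D.Formal r} (hu : u ∈ D.homog r p) :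
    D.minus r u ∈ D.homog r p := by
  rintro (j | j)
  · exact hu _
  · exact zero_mem _

theorem plus_minus_mul_minus (u v : D.Formal r) :
    D.plus r (D.mul r (D.minus r u) (D.minus r v)) = 0 := by
  funext c
  rcases c with j | j
  · rfl
  refine finsum_eq_zero_of_forall_eq_zero fun ⟨a, b⟩ => ?_
  rcases a with a | a
  · rcases b with b | b
    · have h : D.coeff (D.elt (Sum.inl a) * D.elt (Sum.inl b)) (Sum.inr j) = 0 :=
        S.neg_isotropic (D.neg_mem j).1 (S.neg.mul_mem (D.neg_mem a).1 (D.neg_mem b).1)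
      rw [h, zero_smul]
    · change _ • (_ * tw _ 0) = _
      rw [map_zero, mul_zero, smul_zero]
  · change _ • (0 * _) = _
    rw [zero_mul, smul_zero]

theorem minus_plus_mul_plus (u v : D.Formal r) :
    D.minus r (D.mul r (D.plus r u) (D.plus r v)) = 0 := by
  funext c
  rcases c with j | j
  swap
  · rfl
  refine finsum_eq_zero_of_forall_eq_zero fun ⟨a, b⟩ => ?_
  rcases a with a | a
  · change _ • (0 * _) = _
    rw [zero_mul, smul_zero]
  · rcases b with b | b
    · change _ • (_ * tw _ 0) = _
      rw [map_zero, mul_zero, smul_zero]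
    · have h : D.coeff (D.elt (Sum.inr a) * D.elt (Sum.inr b)) (Sum.inl j) = 0 :=
        S.pos_isotropic (S.pos.mul_mem (D.pos_mem a).1 (D.pos_mem b).1) (D.pos_mem j).1
      rw [h, zero_smul]

theorem pairing_plus_plus (u v : D.Formal r) :
    D.pairing r (D.plus r u) (D.plus r v) = 0 := by
  refine finsum_eq_zero_of_forall_eq_zero fun j => ?_
  change 0 * _ + _ • (_ * tw _ 0) = _
  rw [map_zero, zero_mul, mul_zero, smul_zero, add_zero]

theorem pairing_minus_minus (u v : D.Formal r) :
    D.pairing r (D.minus r u) (D.minus r v) = 0 := by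
  refine finsum_eq_zero_of_forall_eq_zero fun j => ?_
  change _ * tw _ 0 + _ • (0 * _) = _
  rw [map_zero, zero_mul, mul_zero, smul_zero, add_zero]

/-- The element `a` of `A` as an element of `𝒢̄`. -/
def ofAlg (a : A) : D.Gbar r :=
  ⟨D.emb r a, D.emb_mem_Gbar r a⟩

/-- A superderivation of `𝒫` (or any linear map), applied to all the coefficients of a formal
sum. -/
def mapCoeff
    (Δ : D.Poly r →ₗ[F] D.Poly r) : D.Gbar r →ₗ[F] D.Gbar r where
  toFun u := ⟨fun c => Δ (u.1 c), by
    refine Set.Finite.subset u.2 fun j hj h => hj ?_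
    change Δ (u.1 (Sum.inr j)) = 0
    rw [h, map_zero]⟩
  map_add' u v := Subtype.ext (by funext c; exact map_add Δ _ _)
  map_smul' t u := Subtype.ext (by funext c; exact map_smul Δ _ _)

variable {D}

variable [hS : Fact S.IsSemiFinitelyFiltered]

instance : NonUnitalRing (D.Gbar r) where
  mul u v := ⟨D.mul r u.1 v.1, D.mul_mem_Gbar hS.out r u.2 v.2⟩
  left_distrib u v w := Subtype.ext (D.mul_add_right r hS.out u.2 v.2 w.2)
  right_distrib u v w := Subtype.ext (D.mul_add_left r hS.out u.2 v.2 w.2)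
  zero_mul u := Subtype.ext (by
    funext c
    refine finsum_eq_zero_of_forall_eq_zero fun p => ?_
    change _ • (0 * _) = _
    rw [zero_mul, smul_zero])
  mul_zero u := Subtype.ext (by
    funext c
    refine finsum_eq_zero_of_forall_eq_zero fun p => ?_
    change _ • (_ * tw _ 0) = _
    rw [map_zero, mul_zero, smul_zero])
  mul_assoc u v w := Subtype.ext (D.mul_assoc_Gbar r hS.out u.2 v.2 w.2)

instance : IsScalarTower F (D.Gbar r) (D.Gbar r) :=
  ⟨fun t u v => Subtype.ext (D.mul_smul_left r hS.out t u.2 v.2)⟩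

instance : SMulCommClass F (D.Gbar r) (D.Gbar r) :=
  ⟨fun t u v => Subtype.ext (D.mul_smul_right r hS.out t u.2 v.2).symm⟩

variable (D) in
/-- The decomposition `u = u_+ + u_-` and the bilinear form of `𝒢̄`. -/
def splitting :
    Splitting F (D.Gbar r) (D.Poly r) where
  gr p := (D.homog r p).comap (D.Gbar r).subtype
  form := LinearMap.mk₂ F (fun u v => D.pairing r u.1 v.1)
    (fun u v w => D.pairing_add_left r u.2 v.2 w.2) (fun t u v => D.pairing_smul_left r t u.2 v.2)
    (fun u v w => D.pairing_add_right r u.2 v.2 w.2)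
    (fun t u v => D.pairing_smul_right r t u.2 v.2)
  plus :=
    { toFun := fun u => ⟨D.plus r u.1, D.plus_mem_Gbar r u.2⟩
      map_add' := fun u v => Subtype.ext (D.plus_add r u.1 v.1)
      map_smul' := fun t u => Subtype.ext (D.plus_smul r t u.1) }
  minus :=
    { toFun := fun u => ⟨D.minus r u.1, D.minus_mem_Gbar r u.1⟩
      map_add' := fun u v => Subtype.ext (D.minus_add r u.1 v.1)
      map_smul' := fun t u => Subtype.ext (D.minus_smul r t u.1) }
  mul_mem hu hv := D.mul_mem_homog r hu hv
  plus_mem hu := D.plus_mem_homog r hu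
  minus_mem hu := D.minus_mem_homog r hu
  form_assoc u v w := D.pairing_assoc r hS.out u.2 v.2 w.2
  form_symm {_ _ u v} hu hv := D.pairing_symm r u.2 v.2 hu hv
  plus_add_minus u := Subtype.ext (by
    funext c; rcases c with j | j; exacts [zero_add _, add_zero _])
  minus_plus_mul_plus u v := Subtype.ext (D.minus_plus_mul_plus r u.1 v.1)
  plus_minus_mul_minus u v := Subtype.ext (D.plus_minus_mul_minus r u.1 v.1)
  form_plus_plus u v := D.pairing_plus_plus r u.1 v.1
  form_minus_minus u v := D.pairing_minus_minus r u.1 v.1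

variable {r}

theorem mem_gr {p : ZMod 2} {u : D.Gbar r} : u ∈ (D.splitting r).gr p ↔
    ∀ c, u.1 c ∈ SuperPoly.part (D.vpar r) (D.ipar c + p) := Iff.rfl

/-! ### Central elements -/

theorem ofAlg_mul (a b : A) : D.ofAlg r a * D.ofAlg r b = D.ofAlg r (a * b) :=
  Subtype.ext (D.emb_mul_emb r hS.out a b)

theorem ofAlg_mem_gr {a : A} (ha : a ∈ S.gr 0) : D.ofAlg r a ∈ (D.splitting r).gr 0 := by
  intro c
  change algebraMap F (D.Poly r) (D.coeff a c) ∈ _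
  by_cases hc : D.ipar c = 0
  · rw [hc]
    exact SuperPoly.algebraMap_mem_part (par := D.vpar r) _
  · rw [D.coeff_eq_zero_of_ne ha hc, map_zero]
    exact zero_mem _

theorem ext_form {u v : D.Gbar r} (h : ∀ c, (D.splitting r).form u (D.ofAlg r (D.elt c)) =
    (D.splitting r).form v (D.ofAlg r (D.elt c))) : u = v :=
  Subtype.ext (D.eq_of_pairing_eq r u.2 v.2 h)

theorem exists_add_of_gr (u : D.Gbar r) : ∃ u₀ ∈ (D.splitting r).gr 0,
    ∃ u₁ ∈ (D.splitting r).gr 1, u = u₀ + u₁ :=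
  ⟨⟨_, D.comp_mem_Gbar r 0 u.2⟩, D.comp_mem_homog r 0 u.1,
    ⟨_, D.comp_mem_Gbar r 1 u.2⟩, D.comp_mem_homog r 1 u.1,
    Subtype.ext (D.homog_comp_add_comp r u.1).symm⟩

/-- An even central element of `A` is central in `𝒢̄`. Since the formal sums are infinite this is
deduced from nondegeneracy and associativity of the form. -/
theorem ofAlg_mul_comm {κ : A} (hκ : κ ∈ S.gr 0) (hκc : ∀ a, κ * a = a * κ)
    (u : D.Gbar r) : D.ofAlg r κ * u = u * D.ofAlg r κ := by
  have hK : D.ofAlg r κ ∈ (D.splitting r).gr 0 := ofAlg_mem_gr hκ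
  have h : ∀ v, (D.splitting r).form (D.ofAlg r κ) v = (D.splitting r).form v (D.ofAlg r κ) :=
    fun v => Splitting.form_comm_even_of_exists hK (exists_add_of_gr v)
  refine ext_form fun c => ?_
  have e : D.ofAlg r κ * D.ofAlg r (D.elt c) = D.ofAlg r (D.elt c) * D.ofAlg r κ := by
    rw [ofAlg_mul, ofAlg_mul, hκc]
  rw [Splitting.form_assoc, h, Splitting.form_assoc, Splitting.form_assoc, e]

/-! ### Superderivations of `𝒫` acting on coefficients -/

theorem mapCoeff_minus (Δ : D.Poly r →ₗ[F] D.Poly r) (u : D.Gbar r) :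
    D.mapCoeff r Δ ((D.splitting r).minus u) =
      (D.splitting r).minus (D.mapCoeff r Δ u) := by
  refine Subtype.ext (funext fun c => ?_)
  rcases c with j | j
  · rfl
  · exact map_zero Δ

variable {p : ZMod 2} {Δ : D.Poly r →ₗ[F] D.Poly r}

theorem map_mul_twist (hΔ : SuperPoly.IsSuperderivation p Δ) {q : ZMod 2} {u : D.Gbar r}
    (hu : u ∈ (D.splitting r).gr q) (c : D.Idx) (g : D.Poly r) :
    Δ (u.1 c * tw (D.ipar c) g) =
      Δ (u.1 c) * tw (D.ipar c) g + sgn F (p * q) • (u.1 c * tw (D.ipar c) (Δ g)) := by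
  rw [hΔ.map_mul, SuperPoly.twist_of_mem p (mem_gr.1 hu c), hΔ.map_twist, mul_smul_comm,
    smul_mul_assoc, smul_smul, ← sgn_add]
  congr 3
  linear_combination (D.ipar c * p) * (CharTwo.two_eq_zero (R := ZMod 2))

theorem mapCoeff_mul (hΔ : SuperPoly.IsSuperderivation p Δ) {q : ZMod 2} {u : D.Gbar r}
    (hu : u ∈ (D.splitting r).gr q) (v : D.Gbar r) :
    D.mapCoeff r Δ (u * v) =
      D.mapCoeff r Δ u * v + sgn F (p * q) • (u * D.mapCoeff r Δ v) := by
  refine Subtype.ext (funext fun c => ?_)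
  have h := fun (u v : D.Gbar r) => D.mul_support_finite hS.out r u.2 v.2 c
  change Δ (∑ᶠ p : D.Idx × D.Idx, _) = D.mul r _ _ c + sgn F (p * q) • D.mul r _ _ c
  rw [map_finsum Δ (h u v), mul, mul, smul_finsum' _ (h u (D.mapCoeff r Δ v))]
  refine Eq.trans (finsum_congr fun a => ?_) (finsum_add_distrib (h (D.mapCoeff r Δ u) v)
    ((h u (D.mapCoeff r Δ v)).subset (Function.support_const_smul_subset (sgn F (p * q)) _)))
  rw [map_smul, map_mul_twist hΔ hu, smul_add, smul_comm (sgn F _)]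
  rfl

theorem map_form (hΔ : SuperPoly.IsSuperderivation p Δ) {q : ZMod 2} {u : D.Gbar r}
    (hu : u ∈ (D.splitting r).gr q) (v : D.Gbar r) :
    Δ ((D.splitting r).form u v) = (D.splitting r).form (D.mapCoeff r Δ u) v +
      sgn F (p * q) • (D.splitting r).form u (D.mapCoeff r Δ v) := by
  have h := fun (u v : D.Gbar r) => D.pairing_support_finite r u.2 v.2
  change Δ (D.pairing r u.1 v.1) = D.pairing r (D.mapCoeff r Δ u).1 v.1 +
    sgn F (p * q) • D.pairing r u.1 (D.mapCoeff r Δ v).1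
  rw [D.pairing_eq r u.2 v.2, D.pairing_eq r (D.mapCoeff r Δ u).2 v.2,
    D.pairing_eq r u.2 (D.mapCoeff r Δ v).2, map_finsum Δ (h u v),
    smul_finsum' _ (h u (D.mapCoeff r Δ v))]
  refine Eq.trans (finsum_congr fun a => ?_) (finsum_add_distrib (h (D.mapCoeff r Δ u) v)
    ((h u (D.mapCoeff r Δ v)).subset (Function.support_const_smul_subset (sgn F (p * q)) _)))
  rw [map_smul, map_mul_twist hΔ hu, smul_add, smul_comm (sgn F _)]
  rfl

/-- A superderivation which annihilates the coefficients of `X` and maps `L` to `E` acts on the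
Hamiltonian vector field of `X` by `fieldDeriv`. -/
theorem mapCoeff_field (hΔ : SuperPoly.IsSuperderivation p Δ) {q : ZMod 2} {L X : D.Gbar r}
    (hL : L ∈ (D.splitting r).gr 0) (hX : X ∈ (D.splitting r).gr q)
    (hΔX : D.mapCoeff r Δ X = 0) :
    D.mapCoeff r Δ ((D.splitting r).field L X) =
      (D.splitting r).fieldDeriv L X (D.mapCoeff r Δ L) (sgn F (p * q)) := by
  have hLX := (D.splitting r).mul_mem hL hX
  rw [zero_add] at hLX
  simp only [Splitting.field, Splitting.fieldDeriv, map_sub,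
    mapCoeff_mul hΔ ((D.splitting r).minus_mem hLX), mapCoeff_mul hΔ hL, mapCoeff_mul hΔ hX,
    mapCoeff_minus, hΔX, zero_mul, mul_zero, smul_zero, add_zero, zero_add, sgn_zero, one_smul,
    map_smul, mul_smul_comm]
  abel

end DualBases

end PolarizedAlgebra

/-! ### Reduction of the Jacobi identity to the variables -/

namespace SuperPoly

variable {F : Type*} [Field F] {V : Type*} {par : V → ZMod 2}

theorem IsSuperderivation.comm {p q : ZMod 2} {Δ Δ' : SuperPoly F par →ₗ[F] SuperPoly F par}
    (h : IsSuperderivation p Δ) (h' : IsSuperderivation q Δ') :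
    IsSuperderivation (p + q) (Δ ∘ₗ Δ' - sgn F (p * q) • (Δ' ∘ₗ Δ)) where
  map_mul f g := by
    simp only [LinearMap.sub_apply, LinearMap.smul_apply, LinearMap.comp_apply, h.map_mul,
      h'.map_mul, map_add, h.map_twist, h'.map_twist, twist_twist, smul_mul_assoc, smul_add,
      sub_mul, mul_sub, mul_smul_comm, smul_smul]
    rw [mul_comm q p, sgn_mul_self, add_comm q p]
    module
  map_mem {i f} hf := by
    have h₁ := h.map_mem (h'.map_mem hf)
    have h₂ := h'.map_mem (h.map_mem hf)
    rw [add_assoc, add_comm q p] at h₁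
    rw [add_assoc] at h₂
    exact sub_mem h₁ (Submodule.smul_mem _ _ h₂)

/-- A skew-supersymmetric biderivation of the algebra of supersymmetric polynomials satisfies the
Jacobi identity if it does so on the variables. -/
theorem jacobi_of_X {B : SuperPoly F par →ₗ[F] SuperPoly F par →ₗ[F] SuperPoly F par}
    (hder : ∀ {i : ZMod 2} {f : SuperPoly F par}, f ∈ part par i → IsSuperderivation i (B f))
    (hskew : ∀ {i j : ZMod 2} {f g : SuperPoly F par}, f ∈ part par i → g ∈ part par j →
      B f g = -(sgn F (i * j) • B g f))
    (hX : ∀ a b c : V, B (X par a) (B (X par b) (X par c)) = B (B (X par a) (X par b)) (X par c) +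
      sgn F (par a * par b) • B (X par b) (B (X par a) (X par c)))
    {i j : ZMod 2} {f g : SuperPoly F par} (hf : f ∈ part par i) (hg : g ∈ part par j)
    (h : SuperPoly F par) :
    B f (B g h) = B (B f g) h + sgn F (i * j) • B g (B f h) := by
  -- Both sides are superderivations in `h`, so `h` may be taken to be a variable.
  have ext : ∀ {i j : ZMod 2} {f g : SuperPoly F par}, f ∈ part par i → g ∈ part par j →
      (∀ c, B f (B g (X par c)) = B (B f g) (X par c) + sgn F (i * j) • B g (B f (X par c))) →
      ∀ h, B f (B g h) = B (B f g) h + sgn F (i * j) • B g (B f h) := by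
    intro i j f g hf hg hc h
    have hfg := (hder hf).map_mem hg
    rw [add_comm] at hfg
    have := ((hder hf).comm (hder hg)).ext_X (hder hfg) fun v => sub_eq_of_eq_add (hc v)
    exact eq_add_of_sub_eq (LinearMap.congr_fun this h)
  -- By skew-symmetry the identity at `(f, g, h)` is equivalent to those at `(f, h, g)` and at
  -- `(g, f, h)`, so each of the three arguments can be moved to the place of `h`.
  have swap : ∀ {i j k : ZMod 2} {f g h : SuperPoly F par}, f ∈ part par i → g ∈ part par j →
      h ∈ part par k → B f (B g h) = B (B f g) h + sgn F (i * j) • B g (B f h) →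
      B f (B h g) = B (B f h) g + sgn F (i * k) • B h (B f g) := by
    intro i j k f g h hf hg hh H
    have hfg := (hder hf).map_mem hg
    have hfh := (hder hf).map_mem hh
    rw [hskew hg hh, map_neg, map_smul, hskew hfg hh, hskew hg hfh] at H
    have e₁ : sgn F ((j + i) * k) = sgn F (j * k) * sgn F (i * k) := by rw [add_mul, sgn_add]
    have e₂ : sgn F (i * j) * sgn F (j * (k + i)) = sgn F (j * k) := by
      rw [mul_add, sgn_add, mul_comm i j, mul_left_comm, sgn_mul_self, mul_one]
    rw [e₁, smul_neg, smul_smul, e₂] at H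
    have H' := congrArg (fun x => -(sgn F (j * k) • x)) H
    simp only [smul_neg, smul_add, neg_neg, neg_add_rev, smul_smul, ← mul_assoc, sgn_mul_self,
      one_smul, one_mul] at H'
    rw [H']
  have swap' : ∀ {i j : ZMod 2} {f g : SuperPoly F par}, f ∈ part par i → g ∈ part par j →
      ∀ {h}, B f (B g h) = B (B f g) h + sgn F (i * j) • B g (B f h) →
      B g (B f h) = B (B g f) h + sgn F (j * i) • B f (B g h) := by
    intro i j f g hf hg h H
    rw [H, hskew hf hg, mul_comm j i]
    simp only [map_neg, map_smul, LinearMap.neg_apply, LinearMap.smul_apply, smul_add, smul_neg,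
      smul_smul, sgn_mul_self, one_smul]
    abel
  have s₁ : ∀ a {j : ZMod 2} {g : SuperPoly F par}, g ∈ part par j → ∀ h,
      B (X par a) (B g h) = B (B (X par a) g) h + sgn F (par a * j) • B g (B (X par a) h) :=
    fun a j g hg h => ext (X_mem_part a) hg (fun c => swap (X_mem_part a) (X_mem_part c) hg
      (ext (X_mem_part a) (X_mem_part c) (hX a c) g)) h
  exact ext hf hg (fun c => swap hf (X_mem_part c) hg (swap' (X_mem_part c) hf (s₁ c hf g))) h

end SuperPoly

namespace PolarizedAlgebra

variable {F A : Type*} [Field F] [NonUnitalRing A] [Module F A]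
  [IsScalarTower F A A] [SMulCommClass F A A]

theorem filt_le_filt_succ (S : PolarizedAlgebra F A) (m : ℕ) : S.filt m ≤ S.filt (m + 1) := by
  have mono : ∀ {W W' : Submodule F A}, W ≤ W' → S.filtStep W ≤ S.filtStep W' :=
    fun h u hu => ⟨hu.1, fun a ha => sup_le_sup_right h _ (hu.2 a ha)⟩
  induction m with
  | zero => exact mono bot_le
  | succ m ih => exact mono ih

namespace DualBases

variable {S : PolarizedAlgebra F A} {J : Type*} (D : S.DualBases J) (r : ℕ)

local notation "tw" => SuperPoly.twist (D.vpar r)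

/-! ### Differentials, and the derivations defined by formal sums -/

open Classical in
/-- The partial derivative with respect to the variable of index `c`, or `0` if there is no such
variable. -/
def pdIdx : D.Idx → D.Poly r →ₗ[F] D.Poly r :=
  Sum.elim (fun j => SuperPoly.pd (D.vpar r) (Sum.inl j))
    (fun j => if h : D.pos j ∈ S.filt r then SuperPoly.pd (D.vpar r) (Sum.inr ⟨j, h⟩) else 0)

/-- The index of a variable. -/
def varIdx : D.Var r → D.Idx := Sum.map id Subtype.val

theorem isSuperderivation_pdIdx (c : D.Idx) :
    SuperPoly.IsSuperderivation (D.ipar c) (D.pdIdx r c) := by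
  rcases c with j | j
  · exact SuperPoly.isSuperderivation_pd (par := D.vpar r) (Sum.inl j)
  · by_cases h : D.pos j ∈ S.filt r
    · have e : D.pdIdx r (Sum.inr j) = SuperPoly.pd (D.vpar r) (Sum.inr ⟨j, h⟩) := dif_pos h
      rw [e]
      exact SuperPoly.isSuperderivation_pd (par := D.vpar r) (Sum.inr ⟨j, h⟩)
    · have e : D.pdIdx r (Sum.inr j) = 0 := dif_neg h
      rw [e]
      exact ⟨fun f g => by simp, fun _ => zero_mem _⟩

theorem pdIdx_X_self (v : D.Var r) : D.pdIdx r (D.varIdx r v) (SuperPoly.X (D.vpar r) v) = 1 := by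
  rcases v with j | ⟨j, h⟩
  · exact SuperPoly.pd_X_self _ _
  · have e : D.pdIdx r (Sum.inr j) = SuperPoly.pd (D.vpar r) (Sum.inr ⟨j, h⟩) := dif_pos h
    exact e ▸ SuperPoly.pd_X_self _ _

theorem pdIdx_X_of_ne {c : D.Idx} {v : D.Var r} (hc : c ≠ D.varIdx r v) :
    D.pdIdx r c (SuperPoly.X (D.vpar r) v) = 0 := by
  rcases c with j | j
  · exact SuperPoly.pd_X_of_ne _ fun h => hc (by rw [← h]; rfl)
  · by_cases h : D.pos j ∈ S.filt r
    · have e : D.pdIdx r (Sum.inr j) = SuperPoly.pd (D.vpar r) (Sum.inr ⟨j, h⟩) := dif_pos h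
      rw [e]
      exact SuperPoly.pd_X_of_ne _ fun h => hc (by rw [← h]; rfl)
    · have e : D.pdIdx r (Sum.inr j) = 0 := dif_neg h
      rw [e, LinearMap.zero_apply]

theorem finite_pdIdx (f : D.Poly r) : {c | D.pdIdx r c f ≠ 0}.Finite := by
  refine ((SuperPoly.finite_pd f).image (D.varIdx r)).subset ?_
  rintro (j | j) hj
  · exact ⟨Sum.inl j, hj, rfl⟩
  · by_cases h : D.pos j ∈ S.filt r
    · have e : D.pdIdx r (Sum.inr j) = SuperPoly.pd (D.vpar r) (Sum.inr ⟨j, h⟩) := dif_pos h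
      exact ⟨Sum.inr ⟨j, h⟩, fun h0 => hj (e ▸ h0), rfl⟩
    · have e : D.pdIdx r (Sum.inr j) = 0 := dif_neg h
      exact absurd (by rw [e, LinearMap.zero_apply]) hj

theorem differential_inr (f : D.Poly r) (j : J) : D.differential r f (Sum.inr j) =
    sgn F (D.par j) • D.pdIdx r (Sum.inl j) (SuperPoly.comp (D.vpar r) 0 f) +
      D.pdIdx r (Sum.inl j) (SuperPoly.comp (D.vpar r) 1 f) := rfl

theorem differential_inl (f : D.Poly r) (j : J) : D.differential r f (Sum.inl j) =
    D.pdIdx r (Sum.inr j) (SuperPoly.comp (D.vpar r) 0 f) +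
      sgn F (D.par j) • D.pdIdx r (Sum.inr j) (SuperPoly.comp (D.vpar r) 1 f) := by
  by_cases h : D.pos j ∈ S.filt r
  · simp [differential, pdIdx, h]
  · simp [differential, pdIdx, h]

/-- The signs in the definition of `ς_(f)` are such that pairing with it is differentiation: up to
the sign in the bilinear form, the twisted coefficient at `-c` is the partial derivative at `c`. -/
theorem twist_differential (f : D.Poly r) (c : D.Idx) :
    tw (D.ipar c) (D.differential r f c.swap) = D.wt c • D.pdIdx r c f := by
  have h₀ := (D.isSuperderivation_pdIdx r c).map_mem (SuperPoly.comp_mem 0 f)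
  have h₁ := (D.isSuperderivation_pdIdx r c).map_mem (SuperPoly.comp_mem 1 f)
  have e₀ : sgn F (D.ipar c * (0 + D.ipar c)) = sgn F (D.ipar c) := by
    rcases parity_cases (D.ipar c) with h | h <;> simp [h]
  have e₁ : sgn F (D.ipar c * (1 + D.ipar c)) = 1 := by
    rcases parity_cases (D.ipar c) with h | h <;> simp [h, CharTwo.add_self_eq_zero]
  conv_rhs => rw [← SuperPoly.comp_add_comp f, map_add]
  rcases c with j | j
  · rw [Sum.swap_inl, differential_inr, map_add, map_smul, SuperPoly.twist_of_mem _ h₀,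
      SuperPoly.twist_of_mem _ h₁, e₀, e₁, smul_smul]
    change (sgn F (D.par j) * sgn F (D.par j)) • _ + _ = (1 : F) • _
    rw [sgn_mul_self, smul_add]
  · rw [Sum.swap_inr, differential_inl, map_add, map_smul, SuperPoly.twist_of_mem _ h₀,
      SuperPoly.twist_of_mem _ h₁, e₀, e₁, one_smul]
    exact (smul_add (sgn F (D.par j)) _ _).symm

theorem differential_add (f g : D.Poly r) :
    D.differential r (f + g) = D.differential r f + D.differential r g := by
  funext c
  rcases c with j | j
  · simp only [Pi.add_apply, differential_inl, map_add, smul_add]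
    abel
  · simp only [Pi.add_apply, differential_inr, map_add, smul_add]
    abel

theorem differential_smul (t : F) (f : D.Poly r) :
    D.differential r (t • f) = t • D.differential r f := by
  funext c
  rcases c with j | j
  · simp only [Pi.smul_apply, differential_inl, map_smul, smul_add, smul_comm t]
  · simp only [Pi.smul_apply, differential_inr, map_smul, smul_add, smul_comm t]

theorem differential_mem_Gbar (f : D.Poly r) : D.differential r f ∈ D.Gbar r := by
  refine (((D.finite_pdIdx r (SuperPoly.comp (D.vpar r) 0 f)).preimage
    Sum.inl_injective.injOn).union ((D.finite_pdIdx r (SuperPoly.comp (D.vpar r) 1 f)).preimage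
    Sum.inl_injective.injOn)).subset fun j hj => ?_
  by_contra h
  simp only [Set.mem_union, Set.mem_preimage, Set.mem_ofPred_eq, not_or, not_not] at h
  exact hj (by rw [differential_inr, h.1, h.2, smul_zero, add_zero])

/-- The differential `f ↦ ς_(f)` as a linear map. -/
def diff : D.Poly r →ₗ[F] D.Gbar r where
  toFun f := ⟨D.differential r f, D.differential_mem_Gbar r f⟩
  map_add' f g := Subtype.ext (D.differential_add r f g)
  map_smul' t f := Subtype.ext (D.differential_smul r t f)

theorem diff_mem_homog {p : ZMod 2} {f : D.Poly r} (hf : f ∈ SuperPoly.part (D.vpar r) p) :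
    D.differential r f ∈ D.homog r p := by
  have key : ∀ (c : D.Idx) (i : ZMod 2), D.pdIdx r c (SuperPoly.comp (D.vpar r) i f) ∈
      SuperPoly.part (D.vpar r) (D.ipar c + p) := by
    intro c i
    rw [SuperPoly.comp_of_mem hf]
    split_ifs
    · rw [add_comm]
      exact (D.isSuperderivation_pdIdx r c).map_mem hf
    · rw [map_zero]
      exact zero_mem _
  rintro (j | j)
  · rw [differential_inl]
    exact add_mem (key (Sum.inr j) 0) (Submodule.smul_mem _ _ (key (Sum.inr j) 1))
  · rw [differential_inr]
    exact add_mem (Submodule.smul_mem _ _ (key (Sum.inl j) 0)) (key (Sum.inl j) 1)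

/-- The differential of a variable has constant coefficients. -/
theorem mapCoeff_diff_X {p : ZMod 2} {Δ : D.Poly r →ₗ[F] D.Poly r}
    (hΔ : SuperPoly.IsSuperderivation p Δ) (v : D.Var r) :
    D.mapCoeff r Δ (D.diff r (SuperPoly.X (D.vpar r) v)) = 0 := by
  have key : ∀ (c : D.Idx) (i : ZMod 2),
      Δ (D.pdIdx r c (SuperPoly.comp (D.vpar r) i (SuperPoly.X (D.vpar r) v))) = 0 := by
    intro c i
    rw [SuperPoly.comp_of_mem (SuperPoly.X_mem_part v)]
    split_ifs
    · by_cases hc : c = D.varIdx r v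
      · rw [hc, pdIdx_X_self, hΔ.map_one]
      · rw [D.pdIdx_X_of_ne r hc, map_zero]
    · rw [map_zero, map_zero]
  refine Subtype.ext (funext fun c => ?_)
  rcases c with j | j
  · change Δ (D.differential r _ (Sum.inl j)) = 0
    rw [differential_inl, map_add, map_smul, key, key, smul_zero, add_zero]
  · change Δ (D.differential r _ (Sum.inr j)) = 0
    rw [differential_inr, map_add, map_smul, key, key, smul_zero, add_zero]

variable {D} {r}

theorem form_neg_eq_zero {m : ℕ} {x : A} (hx : x ∈ S.filt m ⊔ S.neg.toSubmodule) {j : J}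
    (hj : D.pos j ∉ S.filt m) : S.form (D.neg j) x = 0 := by
  obtain ⟨w, hw, n, hn, rfl⟩ := Submodule.mem_sup.1 hx
  rw [map_add, S.neg_isotropic (D.neg_mem j).1 hn, S.form_comm_of_mem (D.neg_mem j).2,
    D.form_filtPred (m := m + 1) hw hj, mul_zero, add_zero]

variable [hS : Fact S.IsSemiFinitelyFiltered]

/-- The pairing with `ς_(g)` is the directional derivative of `g`. -/
theorem form_diff (u : D.Gbar r) (g : D.Poly r) :
    (D.splitting r).form u (D.diff r g) = ∑ᶠ c : D.Idx, u.1 c * D.pdIdx r c g := by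
  change D.pairing r u.1 (D.differential r g) = _
  rw [D.pairing_eq r u.2 (D.differential_mem_Gbar r g)]
  refine finsum_congr fun c => ?_
  rw [twist_differential, mul_smul_comm, smul_smul, wt_mul_self, one_smul]

theorem form_diff_X (u : D.Gbar r) (v : D.Var r) :
    (D.splitting r).form u (D.diff r (SuperPoly.X (D.vpar r) v)) = u.1 (D.varIdx r v) := by
  rw [form_diff, finsum_eq_single _ (D.varIdx r v), pdIdx_X_self, mul_one]
  intro c hc
  rw [D.pdIdx_X_of_ne r hc, mul_zero]

/-- A formal sum `u` of parity `p` defines the superderivation `g ↦ ⟨u, ς_(g)⟩` of `𝒫`. -/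
theorem isSuperderivation_form {p : ZMod 2} {u : D.Gbar r} (hu : u ∈ (D.splitting r).gr p) :
    SuperPoly.IsSuperderivation p ((D.splitting r).form u ∘ₗ D.diff r) where
  map_mul f g := by
    have h : ∀ f : D.Poly r, (Function.support fun c : D.Idx => u.1 c * D.pdIdx r c f).Finite :=
      fun f => (D.finite_pdIdx r f).subset fun c hc h0 => hc (by
        change _ * D.pdIdx r c f = 0
        rw [h0, mul_zero])
    have h₁ : (Function.support fun c : D.Idx => u.1 c * D.pdIdx r c f * g).Finite :=
      (h f).subset fun c hc h0 => hc (by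
        change u.1 c * D.pdIdx r c f = 0 at h0
        change u.1 c * D.pdIdx r c f * g = 0
        rw [h0, zero_mul])
    have h₂ : (Function.support fun c : D.Idx =>
        tw p f * (u.1 c * D.pdIdx r c g)).Finite :=
      (h g).subset fun c hc h0 => hc (by
        change u.1 c * D.pdIdx r c g = 0 at h0
        change _ * (u.1 c * D.pdIdx r c g) = 0
        rw [h0, mul_zero])
    have e₁ := map_finsum (LinearMap.mulRight F g) (h f)
    have e₂ := map_finsum (LinearMap.mulLeft F (tw p f)) (h g)
    simp only [LinearMap.mulRight_apply, LinearMap.mulLeft_apply] at e₁ e₂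
    simp only [LinearMap.comp_apply, form_diff]
    rw [e₁, e₂, ← finsum_add_distrib h₁ h₂]
    refine finsum_congr fun c => ?_
    rw [(D.isSuperderivation_pdIdx r c).map_mul, mul_add, ← mul_assoc, ← mul_assoc,
      SuperPoly.mul_eq_twist_mul (mem_gr.1 hu c), SuperPoly.mul_eq_twist_mul (mem_gr.1 hu c)
        (tw (D.ipar c) f), SuperPoly.twist_twist, mul_assoc (tw _ f),
      SuperPoly.mul_eq_twist_mul (mem_gr.1 hu c)]
    congr 4
    linear_combination D.ipar c * (CharTwo.two_eq_zero (R := ZMod 2))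
  map_mem {i f} hf := by
    rw [add_comm]
    exact D.pairing_mem_part r u.2 (D.differential_mem_Gbar r f) hu (D.diff_mem_homog r hf)

/-! ### The Hamiltonian vector fields -/

theorem lax_mem_Gbar (L₀ : A) : D.lax r L₀ ∈ D.Gbar r := by
  refine add_mem (D.emb_mem_Gbar r L₀) ((D.finite_filtPred hS.out (r + 1)).subset fun j hj => ?_)
  by_contra h
  exact hj (dif_neg h)

variable (D r) in
/-- The Lax element `L` in `𝒢̄`. -/
def laxElt (L₀ : A) : D.Gbar r := ⟨D.lax r L₀, lax_mem_Gbar L₀⟩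

theorem laxElt_mem_gr {L₀ : A} (hL₀ : L₀ ∈ S.gr 0) : D.laxElt r L₀ ∈ (D.splitting r).gr 0 := by
  refine mem_gr.2 fun c => add_mem (mem_gr.1 (ofAlg_mem_gr hL₀) c) ?_
  rw [add_zero]
  rcases c with j | j
  · exact SuperPoly.X_mem_part (par := D.vpar r) (Sum.inl j)
  · by_cases h : D.pos j ∈ S.filt r
    · have e : D.generic r (Sum.inr j) = SuperPoly.X (D.vpar r) (Sum.inr ⟨j, h⟩) := dif_pos h
      rw [e]
      exact SuperPoly.X_mem_part (par := D.vpar r) (Sum.inr ⟨j, h⟩)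
    · have e : D.generic r (Sum.inr j) = 0 := dif_neg h
      rw [e]
      exact zero_mem _

theorem evenBounded_le (S : PolarizedAlgebra F A) (m : ℕ) :
    S.evenBounded m ≤ S.filt m ⊔ S.neg.toSubmodule :=
  sup_le (inf_le_left.trans le_sup_right) (inf_le_left.trans le_sup_left)

theorem evenBounded_le_gr (S : PolarizedAlgebra F A) (m : ℕ) : S.evenBounded m ≤ S.gr 0 :=
  sup_le inf_le_right inf_le_right

theorem laxElt_apply_eq_zero {L₀ : A} (hL₀ : L₀ ∈ S.evenBounded (r + 1)) {k : J}
    (hk : D.pos k ∉ S.filt (r + 1)) : (D.laxElt r L₀).1 (Sum.inr k) = 0 := by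
  have h₁ : D.emb r L₀ (Sum.inr k) = 0 := by
    change algebraMap F (D.Poly r) (S.form (D.neg k) L₀) = 0
    rw [form_neg_eq_zero (evenBounded_le S _ hL₀) hk, map_zero]
  have h₂ : D.generic r (Sum.inr k) = 0 := dif_neg fun h => hk (S.filt_le_filt_succ r h)
  change D.emb r L₀ (Sum.inr k) + D.generic r (Sum.inr k) = 0
  rw [h₁, h₂, add_zero]

/-- The coefficients of `L` are bounded by filtration degree `r + 1`, and multiplication by a
negative element lowers the degree, so `u_- L` has positive coefficients only in degrees up to `r`. -/
theorem minus_mul_laxElt_apply {L₀ : A} (hL₀ : L₀ ∈ S.evenBounded (r + 1)) (u : D.Gbar r) {j : J}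
    (hj : D.pos j ∉ S.filt r) :
    ((D.splitting r).minus u * D.laxElt r L₀).1 (Sum.inr j) = 0 := by
  refine finsum_eq_zero_of_forall_eq_zero fun ⟨a, b⟩ => ?_
  rcases a with a | a
  · suffices h : S.form (D.neg j) (D.neg a * D.elt b) = 0 ∨ (D.laxElt r L₀).1 b = 0 by
      rcases h with h | h
      · change S.form (D.neg j) (D.neg a * D.elt b) • _ = _
        rw [h, zero_smul]
      · change _ • (_ * tw _ ((D.laxElt r L₀).1 b)) = _
        rw [h, map_zero, mul_zero, smul_zero]
    rcases b with b | b
    · exact Or.inl (S.neg_isotropic (D.neg_mem j).1 (S.neg.mul_mem (D.neg_mem a).1 (D.neg_mem b).1))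
    · by_cases hb : D.pos b ∈ S.filt (r + 1)
      · exact Or.inl (form_neg_eq_zero (hb.2 _ (D.neg_mem a).1) hj)
      · exact Or.inr (laxElt_apply_eq_zero hL₀ hb)
  · change _ • (0 * _) = _
    rw [zero_mul, smul_zero]

/-- The mirror image of `minus_mul_laxElt_apply`, for the product `L u_-`. -/
theorem laxElt_mul_minus_apply {L₀ : A} (hL₀ : L₀ ∈ S.evenBounded (r + 1)) (u : D.Gbar r) {j : J}
    (hj : D.pos j ∉ S.filt r) :
    (D.laxElt r L₀ * (D.splitting r).minus u).1 (Sum.inr j) = 0 := by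
  refine finsum_eq_zero_of_forall_eq_zero fun ⟨a, b⟩ => ?_
  rcases b with b | b
  · suffices h : S.form (D.neg j) (D.elt a * D.neg b) = 0 ∨ (D.laxElt r L₀).1 a = 0 by
      rcases h with h | h
      · change S.form (D.neg j) (D.elt a * D.neg b) • _ = _
        rw [h, zero_smul]
      · change _ • ((D.laxElt r L₀).1 a * _) = _
        rw [h, zero_mul, smul_zero]
    rcases a with a | a
    · exact Or.inl (S.neg_isotropic (D.neg_mem j).1 (S.neg.mul_mem (D.neg_mem a).1 (D.neg_mem b).1))
    · by_cases ha : D.pos a ∈ S.filt (r + 1)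
      · exact Or.inl (form_neg_eq_zero (S.mul_mem_of_mem_filt (r + 1) _ ha _ (D.neg_mem b).1) hj)
      · exact Or.inr (laxElt_apply_eq_zero hL₀ ha)
  · change _ • (_ * tw _ 0) = _
    rw [map_zero, mul_zero, smul_zero]

/-- If the coefficients of `V` vanish at the indices without a variable, then the superderivation
`g ↦ ⟨V, ς_(g)⟩` maps `L` to `V`: it maps each variable to the corresponding coefficient of `V`. -/
theorem mapCoeff_form_laxElt (L₀ : A) {p : ZMod 2} {V : D.Gbar r} (hV : V ∈ (D.splitting r).gr p)
    (hV₀ : ∀ j, D.pos j ∉ S.filt r → V.1 (Sum.inr j) = 0) :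
    D.mapCoeff r ((D.splitting r).form V ∘ₗ D.diff r) (D.laxElt r L₀) = V := by
  have hder := isSuperderivation_form hV
  have hX : ∀ v, ((D.splitting r).form V ∘ₗ D.diff r) (SuperPoly.X (D.vpar r) v) =
      V.1 (D.varIdx r v) := form_diff_X V
  generalize (D.splitting r).form V ∘ₗ D.diff r = Δ at hder hX ⊢
  refine Subtype.ext (funext fun c => ?_)
  change Δ (algebraMap F (D.Poly r) (D.coeff L₀ c) + D.generic r c) = V.1 c
  rw [map_add, hder.map_algebraMap, zero_add]
  rcases c with j | j
  · exact hX (Sum.inl j)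
  · by_cases h : D.pos j ∈ S.filt r
    · have e : D.generic r (Sum.inr j) = SuperPoly.X (D.vpar r) (Sum.inr ⟨j, h⟩) := dif_pos h
      rw [e]
      exact hX (Sum.inr ⟨j, h⟩)
    · have e : D.generic r (Sum.inr j) = 0 := dif_neg h
      rw [e, hV₀ j h, map_zero]

/-- The Hamiltonian vector field of `X` is tangent to the space of all `L`, so the derivation
which it defines maps `L` to it. -/
theorem mapCoeff_laxElt {L₀ : A} (hL₀ : L₀ ∈ S.evenBounded (r + 1)) {p : ZMod 2} {X : D.Gbar r}
    (hX : X ∈ (D.splitting r).gr p) :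
    D.mapCoeff r ((D.splitting r).form ((D.splitting r).field (D.laxElt r L₀) X) ∘ₗ D.diff r)
      (D.laxElt r L₀) = (D.splitting r).field (D.laxElt r L₀) X := by
  refine mapCoeff_form_laxElt L₀
    (Splitting.field_mem (laxElt_mem_gr (evenBounded_le_gr S _ hL₀)) hX) fun j h => ?_
  change ((D.splitting r).minus (D.laxElt r L₀ * X) * D.laxElt r L₀).1 (Sum.inr j) -
    (D.laxElt r L₀ * (D.splitting r).minus (X * D.laxElt r L₀)).1 (Sum.inr j) = 0
  rw [minus_mul_laxElt_apply hL₀ _ h, laxElt_mul_minus_apply hL₀ _ h, sub_zero]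

end DualBases

end PolarizedAlgebra

/-! ### Pencils of Poisson superbrackets -/

section Pencil

variable {F B : Type*} [Field F] [Ring B] [Algebra F B] {gr : ZMod 2 → Submodule F B}
  {br₁ br₂ : B → B → B}

/-- If `br₂ + t br₁` is a Poisson superbracket for all `t`, then so are all the linear combinations
of `br₁` and `br₂`. The Jacobiator of `a br₁ + b br₂` is a quadratic form in `(a, b)`, so it
vanishes if it does so at the three points `(0, 1)`, `(1, 1)` and `(-1, 1)`. -/
theorem isPoissonSuperpair_of_pencil (h2 : (2 : F) ≠ 0)
    (h : ∀ t : F, IsPoissonSuperbracket gr (fun f g => br₂ f g + t • br₁ f g)) :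
    IsPoissonSuperpair gr br₁ br₂ := by
  have h₀ := h 0
  have h₁ := h 1
  have h₂ := h (-1)
  simp only [zero_smul, add_zero] at h₀
  simp only [one_smul] at h₁
  simp only [neg_smul, one_smul] at h₂
  have al : ∀ f g h, br₁ (f + g) h = br₁ f h + br₁ g h := fun f g h => by
    have := h₁.add_left f g h
    rw [h₀.add_left] at this
    linear_combination (norm := module) this
  have ar : ∀ f g h, br₁ f (g + h) = br₁ f g + br₁ f h := fun f g h => by
    have := h₁.add_right f g h
    rw [h₀.add_right] at this
    linear_combination (norm := module) this
  have sl : ∀ (c : F) f g, br₁ (c • f) g = c • br₁ f g := fun c f g => by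
    have := h₁.smul_left c f g
    rw [h₀.smul_left] at this
    linear_combination (norm := module) this
  have sr : ∀ (c : F) f g, br₁ f (c • g) = c • br₁ f g := fun c f g => by
    have := h₁.smul_right c f g
    rw [h₀.smul_right] at this
    linear_combination (norm := module) this
  have nl : ∀ f g, br₁ (-f) g = -br₁ f g := fun f g => by
    rw [← neg_one_smul F f, sl, neg_one_smul]
  have nr : ∀ f g, br₁ f (-g) = -br₁ f g := fun f g => by
    rw [← neg_one_smul F g, sr, neg_one_smul]
  have nl₂ : ∀ f g, br₂ (-f) g = -br₂ f g := fun f g => by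
    rw [← neg_one_smul F f, h₀.smul_left, neg_one_smul]
  have nr₂ : ∀ f g, br₂ f (-g) = -br₂ f g := fun f g => by
    rw [← neg_one_smul F g, h₀.smul_right, neg_one_smul]
  intro a b
  exact
  { superCommutative := h₀.superCommutative
    add_left := fun f g h => by rw [al, h₀.add_left]; module
    add_right := fun f g h => by rw [ar, h₀.add_right]; module
    smul_left := fun c f g => by rw [sl, h₀.smul_left]; module
    smul_right := fun c f g => by rw [sr, h₀.smul_right]; module
    even := fun {i j f g} hf hg => by
      have e₀ := h₀.even hf hg
      have e₁ := sub_mem (h₁.even hf hg) e₀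
      rw [add_sub_cancel_left] at e₁
      exact add_mem (Submodule.smul_mem _ a e₁) (Submodule.smul_mem _ b e₀)
    skew := fun hf hg => by
      have e₀ := h₀.skew hf hg
      have e₁ := h₁.skew hf hg
      linear_combination (norm := module) a • e₁ + (b - a) • e₀
    jacobi := fun {i j f g} hf hg h => by
      have e₀ := h₀.jacobi hf hg h
      have e₁ := h₁.jacobi hf hg h
      have e₂ := h₂.jacobi hf hg h
      simp only [al, ar, sl, sr, nl, nr, nl₂, nr₂, h₀.add_left, h₀.add_right, h₀.smul_left,
        h₀.smul_right, smul_add, smul_neg] at e₀ e₁ e₂ ⊢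
      have e₁₂ : br₁ f (br₂ g h) + br₂ f (br₁ g h) = br₁ (br₂ f g) h + br₂ (br₁ f g) h +
          sgn F (i * j) • (br₁ g (br₂ f h) + br₂ g (br₁ f h)) := by
        refine smul_right_injective B h2 ?_
        linear_combination (norm := module) e₁ - e₂
      have e₁₁ : br₁ f (br₁ g h) = br₁ (br₁ f g) h + sgn F (i * j) • br₁ g (br₁ f h) := by
        linear_combination (norm := module) e₁ - e₀ - e₁₂
      linear_combination (norm := module) (a * a) • e₁₁ + (a * b) • e₁₂ + (b * b) • e₀
    leibniz := fun {i j f g} hf hg h => by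
      have e₀ := h₀.leibniz hf hg h
      have e₁ := h₁.leibniz hf hg h
      simp only [add_mul, mul_add, smul_add, smul_mul_assoc, mul_smul_comm] at e₀ e₁ ⊢
      linear_combination (norm := module) a • e₁ + (b - a) • e₀ }

end Pencil

namespace Splitting

variable {F G P : Type*} [Field F] [NonUnitalRing G] [Module F G] [IsScalarTower F G G]
  [SMulCommClass F G G] [AddCommGroup P] [Module F P] (T : Splitting F G P)

/-- `field` as a linear map in `X`. -/
def fieldHom (L : G) : G →ₗ[F] G where
  toFun := T.field L
  map_add' X Y := by
    simp only [field, mul_add, add_mul, map_add]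
    abel
  map_smul' t X := by
    simp only [field, mul_smul_comm, smul_mul_assoc, map_smul, smul_sub, RingHom.id_apply]

/-- The Jacobi identity, with the iterated brackets expressed by `fieldDeriv`, and the bracket of a
bracket brought into this form by skew-symmetry. -/
theorem form_fieldDeriv_jacobi {L X Y Z : G} {p q z : ZMod 2} (hL : L ∈ T.gr 0)
    (hX : X ∈ T.gr p) (hY : Y ∈ T.gr q) (hZ : Z ∈ T.gr z) :
    T.form (T.fieldDeriv L Y (T.field L X) (sgn F (p * q))) Z =
      -(sgn F ((p + q) * z) • T.form (T.fieldDeriv L X (T.field L Z) (sgn F (z * p))) Y) +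
        sgn F (p * q) • T.form (T.fieldDeriv L X (T.field L Y) (sgn F (q * p))) Z := by
  rw [form_fieldDeriv hL hX hY (field_mem hL hZ),
    ← form_field_skew hL (grad_mem _ hL hX hY) hZ, ← fieldDeriv_sub_fieldDeriv, mul_comm q p,
    map_sub, map_smul, LinearMap.sub_apply, LinearMap.smul_apply, sub_add_cancel]

/-- The supercommutator, given the projections `c p` onto the parts of parity `p`. -/
def commutator (c : ZMod 2 → G →ₗ[F] G) : G →ₗ[F] G →ₗ[F] G :=
  ∑ p : ZMod 2, ∑ q : ZMod 2, (((LinearMap.mul F G).comp (c p)).compl₂ (c q) -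
    sgn F (p * q) • ((LinearMap.mul F G).flip.comp (c p)).compl₂ (c q))

theorem commutator_apply (c : ZMod 2 → G →ₗ[F] G) (u v : G) :
    commutator c u v = ∑ p : ZMod 2, ∑ q : ZMod 2,
      (c p u * c q v - sgn F (p * q) • (c q v * c p u)) := by
  simp only [commutator, LinearMap.sum_apply, LinearMap.sub_apply, LinearMap.smul_apply,
    LinearMap.compl₂_apply, LinearMap.comp_apply, LinearMap.flip_apply, LinearMap.mul_apply']

theorem commutator_of_mem {c : ZMod 2 → G →ₗ[F] G}
    (hc : ∀ {p : ZMod 2} {u : G}, u ∈ T.gr p → ∀ q, c q u = if p = q then u else 0)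
    {p q : ZMod 2} {u v : G} (hu : u ∈ T.gr p) (hv : v ∈ T.gr q) :
    commutator c u v = u * v - sgn F (p * q) • (v * u) := by
  rw [commutator_apply, Finset.sum_eq_single p, Finset.sum_eq_single q]
  · rw [hc hu, hc hv, if_pos rfl, if_pos rfl]
  · intro q' _ h
    rw [hc hv, if_neg h.symm, mul_zero, zero_mul, smul_zero, sub_zero]
  · exact fun h => absurd (Finset.mem_univ _) h
  · intro p' _ h
    refine Finset.sum_eq_zero fun q' _ => ?_
    rw [hc hu, if_neg h.symm, mul_zero, zero_mul, smul_zero, sub_zero]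
  · exact fun h => absurd (Finset.mem_univ _) h

/-- The linear bracket `⟨L, [X, (K Y)_+] - [(K X)_-, Y]⟩` is the pairing of `linearField L K X`
with `Y`. -/
theorem form_commutator_sub_commutator {c : ZMod 2 → G →ₗ[F] G}
    (hc : ∀ {p : ZMod 2} {u : G}, u ∈ T.gr p → ∀ q, c q u = if p = q then u else 0)
    (hG : ∀ u, ∃ u₀ ∈ T.gr 0, ∃ u₁ ∈ T.gr 1, u = u₀ + u₁) {L K : G} (hL : L ∈ T.gr 0)
    (hK : K ∈ T.gr 0) (hKc : ∀ u, K * u = u * K) (X Y : G) :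
    T.form L (commutator c X (T.plus (K * Y)) - commutator c (T.minus (K * X)) Y) =
      T.form (T.linearField L K X) Y := by
  have key : ∀ {p q : ZMod 2} {X Y : G}, X ∈ T.gr p → Y ∈ T.gr q →
      T.form L (commutator c X (T.plus (K * Y)) - commutator c (T.minus (K * X)) Y) =
        T.form (T.linearField L K X) Y := by
    intro p q X Y hX hY
    have hKX := T.mul_mem hK hX
    have hKY := T.mul_mem hK hY
    rw [zero_add] at hKX hKY
    rw [commutator_of_mem T hc hX (T.plus_mem hKY), commutator_of_mem T hc (T.minus_mem hKX) hY,
      form_linearField hL hK hKc hX hY]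
  obtain ⟨X₀, hX₀, X₁, hX₁, rfl⟩ := hG X
  obtain ⟨Y₀, hY₀, Y₁, hY₁, rfl⟩ := hG Y
  simp only [map_add, mul_add, LinearMap.add_apply, linearField_add, map_sub,
    ← key hX₀ hY₀, ← key hX₀ hY₁, ← key hX₁ hY₀, ← key hX₁ hY₁]
  abel

end Splitting

namespace PolarizedAlgebra

namespace DualBases

variable {F A : Type*} [Field F] [NonUnitalRing A] [Module F A]
  [IsScalarTower F A A] [SMulCommClass F A A]
  {S : PolarizedAlgebra F A} {J : Type*} (D : S.DualBases J) (r : ℕ)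
  [hS : Fact S.IsSemiFinitelyFiltered]

/-! ### The two brackets -/

/-- The quadratic bracket as a bilinear map. -/
def quadratic (L₀ : A) : D.Poly r →ₗ[F] D.Poly r →ₗ[F] D.Poly r :=
  ((D.splitting r).form ∘ₗ (D.splitting r).fieldHom (D.laxElt r L₀) ∘ₗ D.diff r).compl₂ (D.diff r)

variable {D r}

theorem diff_mem_gr {p : ZMod 2} {f : D.Poly r} (hf : f ∈ SuperPoly.part (D.vpar r) p) :
    D.diff r f ∈ (D.splitting r).gr p := D.diff_mem_homog r hf

section Quadratic

variable {L₀ : A} (hL₀ : L₀ ∈ S.evenBounded (r + 1))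
include hL₀

theorem isSuperderivation_quadratic {i : ZMod 2} {f : D.Poly r}
    (hf : f ∈ SuperPoly.part (D.vpar r) i) :
    SuperPoly.IsSuperderivation i (D.quadratic r L₀ f) :=
  isSuperderivation_form (Splitting.field_mem (laxElt_mem_gr (evenBounded_le_gr S _ hL₀))
    (diff_mem_gr hf))

theorem quadratic_skew {i j : ZMod 2} {f g : D.Poly r} (hf : f ∈ SuperPoly.part (D.vpar r) i)
    (hg : g ∈ SuperPoly.part (D.vpar r) j) :
    D.quadratic r L₀ f g = -(sgn F (i * j) • D.quadratic r L₀ g f) :=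
  Splitting.form_field_skew (laxElt_mem_gr (evenBounded_le_gr S _ hL₀)) (diff_mem_gr hf)
    (diff_mem_gr hg)

/-- On variables, whose differentials are constant, an iterated bracket is the derivative of the
Hamiltonian vector field. -/
theorem quadratic_quadratic_X {i : ZMod 2} {f : D.Poly r} (hf : f ∈ SuperPoly.part (D.vpar r) i)
    (b c : D.Var r) :
    D.quadratic r L₀ f (D.quadratic r L₀ (SuperPoly.X (D.vpar r) b) (SuperPoly.X (D.vpar r) c)) =
      (D.splitting r).form ((D.splitting r).fieldDeriv (D.laxElt r L₀)
        (D.diff r (SuperPoly.X (D.vpar r) b))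
        ((D.splitting r).field (D.laxElt r L₀) (D.diff r f)) (sgn F (i * D.vpar r b)))
        (D.diff r (SuperPoly.X (D.vpar r) c)) := by
  have hL := laxElt_mem_gr (D := D) (r := r) (evenBounded_le_gr S _ hL₀)
  have hb := diff_mem_gr (D := D) (SuperPoly.X_mem_part b)
  have hder := isSuperderivation_quadratic hL₀ hf
  have hΔL : D.mapCoeff r (D.quadratic r L₀ f) (D.laxElt r L₀) = _ :=
    mapCoeff_laxElt hL₀ (diff_mem_gr hf)
  have h₁ := map_form hder (Splitting.field_mem hL hb) (D.diff r (SuperPoly.X (D.vpar r) c))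
  have h₂ := mapCoeff_field hder hL hb (D.mapCoeff_diff_X r hder b)
  have h₃ : (D.splitting r).form ((D.splitting r).field (D.laxElt r L₀)
      (D.diff r (SuperPoly.X (D.vpar r) b))) (D.mapCoeff r (D.quadratic r L₀ f)
        (D.diff r (SuperPoly.X (D.vpar r) c))) = 0 :=
    (congrArg _ (D.mapCoeff_diff_X r hder c)).trans (LinearMap.map_zero _)
  have h₄ := (h₂.trans (by rw [hΔL]) :
    D.mapCoeff r (D.quadratic r L₀ f) ((D.splitting r).field (D.laxElt r L₀)
      (D.diff r (SuperPoly.X (D.vpar r) b))) = (D.splitting r).fieldDeriv (D.laxElt r L₀)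
        (D.diff r (SuperPoly.X (D.vpar r) b))
        ((D.splitting r).field (D.laxElt r L₀) (D.diff r f)) (sgn F (i * D.vpar r b)))
  refine h₁.trans ?_
  refine (congrArg₂ (· + ·) (congrArg (fun u => (D.splitting r).form u _) h₄)
    ((congrArg _ h₃).trans (smul_zero _))).trans (add_zero _)

theorem quadratic_jacobi {i j : ZMod 2} {f g : D.Poly r}
    (hf : f ∈ SuperPoly.part (D.vpar r) i) (hg : g ∈ SuperPoly.part (D.vpar r) j) (h : D.Poly r) :
    D.quadratic r L₀ f (D.quadratic r L₀ g h) = D.quadratic r L₀ (D.quadratic r L₀ f g) h +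
      sgn F (i * j) • D.quadratic r L₀ g (D.quadratic r L₀ f h) := by
  refine SuperPoly.jacobi_of_X (isSuperderivation_quadratic hL₀) (quadratic_skew hL₀)
    (fun a b c => ?_) hf hg h
  have hL := laxElt_mem_gr (D := D) (r := r) (evenBounded_le_gr S _ hL₀)
  have ha := SuperPoly.X_mem_part (F := F) (par := D.vpar r) a
  have hb := SuperPoly.X_mem_part (F := F) (par := D.vpar r) b
  have hc := SuperPoly.X_mem_part (F := F) (par := D.vpar r) c
  have hab := (isSuperderivation_quadratic hL₀ ha).map_mem hb
  rw [add_comm] at hab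
  rw [quadratic_quadratic_X hL₀ ha, quadratic_quadratic_X hL₀ hb, quadratic_skew hL₀ hab hc,
    quadratic_quadratic_X hL₀ hc]
  exact (D.splitting r).form_fieldDeriv_jacobi hL (diff_mem_gr ha) (diff_mem_gr hb)
    (diff_mem_gr hc)

theorem isPoissonSuperbracket_bracket₂ :
    IsPoissonSuperbracket (SuperPoly.part (D.vpar r)) (D.bracket₂ r L₀) where
  superCommutative := SuperPoly.isSuperCommutative
  add_left f g h := LinearMap.congr_fun (map_add (D.quadratic r L₀) f g) h
  add_right f g h := map_add (D.quadratic r L₀ f) g h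
  smul_left c f g := LinearMap.congr_fun (map_smul (D.quadratic r L₀) c f) g
  smul_right c f g := map_smul (D.quadratic r L₀ f) c g
  even hf hg := by
    rw [add_comm]
    exact (isSuperderivation_quadratic hL₀ hf).map_mem hg
  skew hf hg := quadratic_skew hL₀ hf hg
  jacobi hf hg h := quadratic_jacobi hL₀ hf hg h
  leibniz {i j f g} hf hg h := by
    have e := (isSuperderivation_quadratic hL₀ hf).map_mul g h
    rw [SuperPoly.twist_of_mem _ hg, smul_mul_assoc] at e
    exact e

end Quadratic

variable (D r) in
/-- The projection of `𝒢̄` onto its part of parity `p`. -/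
def compElt (p : ZMod 2) : D.Gbar r →ₗ[F] D.Gbar r where
  toFun u := ⟨D.comp r p u.1, D.comp_mem_Gbar r p u.2⟩
  map_add' u v := Subtype.ext (by funext c; exact map_add (SuperPoly.comp _ _) _ _)
  map_smul' t u := Subtype.ext (by funext c; exact map_smul (SuperPoly.comp _ _) _ _)

theorem compElt_of_mem {p : ZMod 2} {u : D.Gbar r} (hu : u ∈ (D.splitting r).gr p) (q : ZMod 2) :
    D.compElt r q u = if p = q then u else 0 := by
  refine Subtype.ext ((D.comp_of_mem_homog r hu q).trans ?_)
  split_ifs <;> rfl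

theorem commutator_val (u v : D.Gbar r) :
    (Splitting.commutator (D.compElt r) u v).1 = D.commutator r u.1 v.1 := by
  rw [Splitting.commutator_apply]
  simp only [Submodule.coe_sum, commutator]
  rfl

/-- The first bracket is the linearization of the second one in the direction `κ`. -/
theorem bracket₁_eq_form {L₀ κ : A} (hL₀ : L₀ ∈ S.gr 0) (hκ : κ ∈ S.gr 0)
    (hκc : ∀ a, κ * a = a * κ) (f g : D.Poly r) : D.bracket₁ r L₀ κ f g =
      (D.splitting r).form ((D.splitting r).linearField (D.laxElt r L₀) (D.ofAlg r κ)
        (D.diff r f)) (D.diff r g) := by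
  rw [← (D.splitting r).form_commutator_sub_commutator compElt_of_mem exists_add_of_gr
    (laxElt_mem_gr hL₀) (ofAlg_mem_gr hκ) (ofAlg_mul_comm hκ hκc)]
  refine congrArg (D.pairing r (D.lax r L₀)) ?_
  refine Eq.trans ?_ (congrArg₂ (· - ·) (commutator_val _ _) (commutator_val _ _)).symm
  rfl

theorem laxElt_add_smul (L₀ κ : A) (t : F) :
    D.laxElt r (L₀ + t • κ) = D.laxElt r L₀ + t • D.ofAlg r κ := by
  have h : D.emb r (L₀ + t • κ) = D.emb r L₀ + t • D.emb r κ := by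
    funext c
    have hc : D.coeff (L₀ + t • κ) c = D.coeff L₀ c + t * D.coeff κ c := by
      rcases c with j | j <;> simp [coeff]
    change algebraMap F (D.Poly r) (D.coeff (L₀ + t • κ) c) = algebraMap F (D.Poly r) _ +
      t • algebraMap F (D.Poly r) _
    rw [hc, map_add, map_mul]
    exact congrArg _ (Algebra.smul_def t (algebraMap F (D.Poly r) (D.coeff κ c))).symm
  refine Subtype.ext ?_
  change D.emb r (L₀ + t • κ) + D.generic r = (D.emb r L₀ + D.generic r) + t • D.emb r κ
  rw [h]
  abel

/-- Shifting `L₀` by multiples of `κ` gives the pencil of the two brackets. -/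
theorem bracket₂_add_smul {L₀ κ : A} (hL₀ : L₀ ∈ S.gr 0) (hκ : κ ∈ S.gr 0)
    (hκc : ∀ a, κ * a = a * κ) (t : F) (f g : D.Poly r) :
    D.bracket₂ r (L₀ + t • κ) f g = D.bracket₂ r L₀ f g + t • D.bracket₁ r L₀ κ f g := by
  have h := Splitting.field_add_smul (T := D.splitting r) (ofAlg_mul_comm hκ hκc) (D.laxElt r L₀)
    (D.diff r f) t
  rw [← laxElt_add_smul] at h
  have h' := LinearMap.congr_fun (congrArg (D.splitting r).form h) (D.diff r g)
  rw [map_add, map_smul] at h'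
  rw [bracket₁_eq_form hL₀ hκ hκc]
  exact h'

end DualBases

end PolarizedAlgebra

end PoissonSuper

end

theorem theorem4p3 {F A J : Type*} [Field F] (hF : ringChar F ≠ 2)
    [NonUnitalRing A] [Module F A] [IsScalarTower F A A] [SMulCommClass F A A]
    (S : PoissonSuper.PolarizedAlgebra F A) (hS : S.IsSemiFinitelyFiltered)
    (D : S.DualBases J) (r : ℕ) (hr : 0 < r)
    (L₀ : A) (hL₀ : L₀ ∈ S.evenBounded (r + 1))
    (κ : A) (hκ : κ ∈ S.evenBounded (r + 1)) (hκ_central : ∀ a : A, κ * a = a * κ) :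
    PoissonSuper.IsPoissonSuperpair (PoissonSuper.SuperPoly.part (D.vpar r))
      (D.bracket₁ r L₀ κ) (D.bracket₂ r L₀) := by
  have : Fact S.IsSemiFinitelyFiltered := ⟨hS⟩
  refine PoissonSuper.isPoissonSuperpair_of_pencil (Ring.two_ne_zero hF) fun t => ?_
  have h : D.bracket₂ r (L₀ + t • κ) =
      fun f g => D.bracket₂ r L₀ f g + t • D.bracket₁ r L₀ κ f g := by
    funext f g
    exact PoissonSuper.PolarizedAlgebra.DualBases.bracket₂_add_smul
      (PoissonSuper.PolarizedAlgebra.DualBases.evenBounded_le_gr S _ hL₀)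
      (PoissonSuper.PolarizedAlgebra.DualBases.evenBounded_le_gr S _ hκ) hκ_central t f g
  rw [← h]
  exact PoissonSuper.PolarizedAlgebra.DualBases.isPoissonSuperbracket_bracket₂
    (add_mem hL₀ (Submodule.smul_mem _ t hκ))
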